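/- For $a\in\mathbb C$ and an integer $k\ge 0$ let $(a)_k=a(a+1)\cdots(a+k-1)$, let ${}_2F_1\left({\alpha,\beta\atop\gamma}\Big|z\right)=\sum_{k\ge0}\frac{(\alpha)_k(\beta)_k}{(\gamma)_k\,k!}z^k$ be the Gauss hypergeometric series, and put $$F^{2:1;1}_{1:1;1}\left({\alpha;\beta;p_1,p_2\atop \gamma;q_1,q_2}\Big|x,y\right)=\sum_{i,j\ge0}\frac{(\alpha)_{i+j}(\beta)_{i+j}(p_1)_i(p_2)_j}{(\gamma)_{i+j}(q_1)_i(q_2)_j\,i!\,j!}x^iy^j,$$ $$F^{1:2;2}_{2:0;0}\left({\alpha;p_1,p_2;q_1,q_2\atop \beta;\gamma}\Big|x,y\right)=\sum_{i,j\ge0}\frac{(\alpha)_{i+j}(p_1)_i(p_2)_j(q_1)_i(q_2)_j}{(\beta)_{i+j}(\gamma)_{i+j}\,i!\,j!}x^iy^j .$$ Let $a,b,c$ be complex numbers and $m,n$ non-negative integers. The following identities hold for all $z$ in a (complex) neighbourhood of $0$, where the infinite double series that occur converge absolutely, and $(1-z)^s$ is the principal branch. 1. If neither $c$ nor $2-c$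 is a non-positive integer, then $${}_2F_1\left({a,b\atop c}\Big|z\right)\,{}_2F_1\left({1+a-c,1+b-c\atop 2-c}\Big|z\right)=(1-z)^{c-a-b-\frac12}\,F^{1:2;2}_{2:0;0}\left({\frac12;\,a-b+\frac12,\,a+b-c+\frac12;\,b-a+\frac12,\,c-a-b+\frac12\atop c;\,2-c}\Big|z,\frac z{z-1}\right).$$ 2. If $a+b+\frac12$ is not a non-positive integer, then $${}_2F_1\left({a,b\atop a+b+n+\frac12}\Big|z\right)^2=\frac{(\frac12)_n\,(a+b+\frac12)_n}{(a+\frac12)_n\,(b+\frac12)_n}\,F^{2:1;1}_{1:1;1}\left({2a;\,2b;\,a+b+n,\,-n\atop a+b+\frac12;\,2a+2b+2n,\,-2n}\Big|z,1-z\right),$$ where the series is understood to terminate in the second argument at the power $(1-z)^n$ and, if $a+b+n$ is a non-positive integer, every coefficient is understood as the limit of the corresponding coefficient for $a,b'$ as $b'\to b$, $b'\ne b$ (these limits exist). If $(a+\frac12)_n(b+\frac12)_n=0$, the identity is understood as multiplied through by this factor. 3. Without restriction on $a$, $$\frac{(a+\frac12)_n(a+m+\frac12)_n}{(\frac12)_n(m+\frac12)_n}\,{}_2F_1\left({a,-a-m-n\atop\frac12-m}\Big|z\right)^2+\frac{(a+\frac12)_m(a+n+\frac12)_m(a)_{m+n+1}^2}{(\frac12)_m(\frac12)_{m+1}^2(\frac12)_n(\frac12)_{m+n}}\,z^{2m+1}\,{}_2F_1\left({a+m+\frac12,\frac12-a-n\atop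 m+\frac32}\Big|z\right)^2$$ $$=F^{2:1;1}_{1:1;1}\left({2a;\,-2a-2m-2n;\,-m,\,-n\atop\frac12-m-n;\,-2m,\,-2n}\Big|z,1-z\right),$$ where the right-hand side is the finite sum over $0\le i\le m$, $0\le j\le n$. -/

import Mathlib

open Filter Topology

/-- The Pochhammer symbol `(a)_k = a (a + 1) ⋯ (a + k - 1)`. -/
noncomputable def poch (a : ℂ) (k : ℕ) : ℂ := (ascPochhammer ℂ k).eval a

/-- The coefficient of `x ^ i * y ^ j` in the double hypergeometric series
`F^{2:1;1}_{1:1;1}(a; b; p₁, p₂ | c; q₁, q₂ | x, y)`. -/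
noncomputable def coeff211 (a b p₁ p₂ c q₁ q₂ : ℂ) (i j : ℕ) : ℂ :=
  (poch a (i + j) * poch b (i + j) * poch p₁ i * poch p₂ j) /
    (poch c (i + j) * poch q₁ i * poch q₂ j * (i.factorial : ℂ) * (j.factorial : ℂ))

/-- The coefficient of `x ^ i * y ^ j` in the double hypergeometric series
`F^{1:2;2}_{2:0;0}(a; p₁, p₂; q₁, q₂ | b; c | x, y)`. -/
noncomputable def coeff122 (a p₁ p₂ q₁ q₂ b c : ℂ) (i j : ℕ) : ℂ :=
  (poch a (i + j) * poch p₁ i * poch p₂ j * poch q₁ i * poch q₂ j) /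
    (poch b (i + j) * poch c (i + j) * (i.factorial : ℂ) * (j.factorial : ℂ))

/-- The `(i, j)` term of the double power series with coefficient array `A`. -/
noncomputable def doubleTerm (A : ℕ → ℕ → ℂ) (x y : ℂ) (p : ℕ × ℕ) : ℂ :=
  A p.1 p.2 * x ^ p.1 * y ^ p.2

/-- The double power series `∑_{i, j ≥ 0} A i j * x ^ i * y ^ j`
(meaningful when its terms are absolutely summable). -/
noncomputable def doubleSeries (A : ℕ → ℕ → ℂ) (x y : ℂ) : ℂ :=
  ∑' p : ℕ × ℕ, doubleTerm A x y p

/-- The coefficient array `A`, terminated in its second index after `j = N`. -/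
noncomputable def terminateSnd (N : ℕ) (A : ℕ → ℕ → ℂ) (i j : ℕ) : ℂ :=
  if j ≤ N then A i j else 0

/-- The rectangular sum `∑_{i = 0}^M ∑_{j = 0}^N A i j * x ^ i * y ^ j`. -/
noncomputable def rectSum (M N : ℕ) (A : ℕ → ℕ → ℂ) (x y : ℂ) : ℂ :=
  ∑ i ∈ Finset.range (M + 1), ∑ j ∈ Finset.range (N + 1), A i j * x ^ i * y ^ j

/-- Coefficients of
`F^{2:1;1}_{1:1;1}(2a; 2b; a+b+n, -n | a+b+1/2; 2a+2b+2n, -2n | x, y)`. -/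
noncomputable def clausenCoeff (a b : ℂ) (n : ℕ) : ℕ → ℕ → ℂ :=
  coeff211 (2 * a) (2 * b) (a + b + n) (-n) (a + b + 1 / 2) (2 * a + 2 * b + 2 * n) (-(2 * n))

/-! Each identity compares two formal power series that solve the same third order linear equation
in the derivation E = X(1-X) d/dX. Such a solution is determined by its coefficients at the
nonnegative integer roots of the indicial polynomial (`eq_zero_of_third_order`), so only these
exponents have to be checked.

On the one-variable side, the square of a solution of the Gauss equation satisfies the symmetric
square equation (`symSq_ode`), and the product in the first identity, corrected by a power of 1-x,
satisfies `product_ode`. On the double series side, the coefficient recurrences in i and in j,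
together with the relation obtained by eliminating between them, are linear relations among the
moments ∑ i^s j^t A(i,j) x^i y^j. Along y = 1-x or y = x/(x-1) the derivation E maps moments to
combinations of moments, and one combination of the relations leaves an equation in Y, EY, E²Y, E³Y
alone (`line_symSq`, `curve_ode`).

For the first identity the exponents at 0 are 0 and ±(c-1), and the hypotheses on c leave only 0.
For the second, with p = a+b+n, they are 0, 1/2-p and 1-2p; the constant coefficient of the double
series is a terminating Watson sum (`watson_sum`, by creative telescoping). If p is a nonpositive
integer then 1-2p is a positive integer and uniqueness fails; this case follows by continuity in b,
once the duplication formula has removed the vanishing factors of (p)_i/(2p)_i.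

In the dihedral case p = -m, so the exponent 2m+1 does occur and carries the second square: the
double sum is Y = αF + γS with F, S squares of Gauss solutions (up to the power of z). Watson's sum
gives α. For γ, the quadratic first integral `symSqForm` equals -4αγ times the squared Wronskian,
hence is a multiple of X^(2m+1)(1-X)^(2n+1). Its lowest coefficient involves αγ, and its top
coefficient is read off from the leading coefficient of the polynomial Y. This determines γ when α ≠
0, and continuity in a does the rest.

Finally all series converge absolutely near 0, so the formal identities may be evaluated. -/

/-! ### Differential algebra: symmetric squares, their first integral, and restriction of double
series to curves. -/

section AbstractODE

variable {S R : Type*} [CommSemiring S] [CommRing R] [Algebra S R] (E : Derivation S R R)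

/-- The symmetric square of the second order equation `E² f = u E f + v f`. -/
theorem symSq_ode {u v f : R} (hf : E (E f) = u * E f + v * f) :
    E (E (E (f * f))) = 3 * u * E (E (f * f)) + (4 * v + E u - 2 * u ^ 2) * E (f * f) +
      (2 * E v - 4 * u * v) * (f * f) := by
  simp only [Derivation.leibniz, smul_eq_mul, map_add, hf]
  ring

/-- The symmetric square equation for `w * f * f`, where `w` behaves like the square of an
integrating factor. -/
theorem symSq_ode_twist {u v u' v' w r f : R} (hf : E (E f) = u' * E f + v' * f)
    (hw : E w = 2 * r * w) (hu : u' = u - 2 * r) (hv : v' = v + u * r - r ^ 2 - E r) :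
    E (E (E (w * (f * f)))) = 3 * u * E (E (w * (f * f))) +
      (4 * v + E u - 2 * u ^ 2) * E (w * (f * f)) +
      (2 * E v - 4 * u * v) * (w * (f * f)) := by
  have h2 : E (2 : R) = 0 := by simpa using E.map_natCast 2
  subst hu hv
  simp only [Derivation.leibniz, smul_eq_mul, map_add, map_sub, hf, hw, pow_two, h2, map_zero]
  ring

/-- The quadratic first integral attached to the symmetric square equation. -/
def symSqForm (u v Y : R) : R :=
  E Y * E Y - 2 * (Y * E (E Y)) + 2 * (u * (Y * E Y)) + 4 * (v * (Y * Y))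

/-- The form is a discriminant: for two solutions f, g its value on αf² + βfg + γg² is (β² - 4αγ)(f
Eg - g Ef)², so it vanishes on a square. -/
theorem symSqForm_sq {u v f : R} (hf : E (E f) = u * E f + v * f) :
    symSqForm E u v (f * f) = 0 := by
  simp only [symSqForm, Derivation.leibniz, smul_eq_mul, map_add, hf]
  ring

/-- The form behaves as a squared Wronskian W², and EW = uW. The third order equation alone
suffices; Y need not be exhibited as a combination of products of solutions. -/
theorem derivation_symSqForm {u v Y : R}
    (hY : E (E (E Y)) = 3 * u * E (E Y) + (4 * v + E u - 2 * u ^ 2) * E Y +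
      (2 * E v - 4 * u * v) * Y) :
    E (symSqForm E u v Y) = 2 * u * symSqForm E u v Y := by
  have h2 : E (2 : R) = 0 := by simpa using E.map_natCast 2
  have h4 : E (4 : R) = 0 := by simpa using E.map_natCast 4
  simp only [symSqForm, Derivation.leibniz, smul_eq_mul, map_add, map_sub, h2, h4]
  linear_combination (-2 * Y) * hY

/-- Reduction to one variable of the system for `F^{2:1;1}_{1:1;1}` on the line `x + y = 1`. -/
theorem restrict_line_ode {x y α β p q g00 g10 g01 g20 g11 g02 g30 g21 g12 g03 : R}
    (hy : y = 1 - x) (hx : E x = x * y) (hq : q = α + β - p)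
    (h00 : E g00 = y * g10 - x * g01)
    (h10 : E g10 = y * g20 - x * g11) (h01 : E g01 = y * g11 - x * g02)
    (h20 : E g20 = y * g30 - x * g21) (h11 : E g11 = y * g21 - x * g12)
    (h02 : E g02 = y * g12 - x * g03)
    (r1 : 2 * (g30 + g21) + (α + β + 2 * p - 3) * g20 + 2 * (p - 1) * g11 +
        (p - 1) * (α + β - 1) * g10 =
      x * (2 * (g30 + 2 * g21 + g12) + (p + 2 * (α + β)) * g20 + 2 * (p + α + β) * g11 + p * g02 +
        (p * (α + β) + 2 * α * β) * g10 + p * (α + β) * g01 + p * α * β * g00))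
    (r2 : 2 * (g03 + g12) + (α + β + 2 * q - 3) * g02 + 2 * (q - 1) * g11 +
        (q - 1) * (α + β - 1) * g01 =
      y * (2 * (g03 + 2 * g12 + g21) + (q + 2 * (α + β)) * g02 + 2 * (q + α + β) * g11 + q * g20 +
        (q * (α + β) + 2 * α * β) * g01 + q * (α + β) * g10 + q * α * β * g00))
    (r3 : y * (2 * g21 + q * g20 + 2 * (p - 1) * g11 + q * (p - 1) * g10) =
      x * (2 * g12 + p * g02 + 2 * (q - 1) * g11 + p * (q - 1) * g01)) :
    4 * E (E (E g00)) =
      -(6 * (p - 1 + (2 - α - β) * x)) * E (E g00) +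
      2 * (2 * α * β * x * y - (2 - α - β) * x * y - (p - 1 + (2 - α - β) * x) ^ 2) * E g00 +
      2 * (α * β * x * y * (y - x) + (p - 1 + (2 - α - β) * x) * α * β * x * y) * g00 := by
  have hEy : E y = -(x * y) := by rw [hy, map_sub, hx, ← hy]; simp
  have e2 : E (E g00) = y * (y * g20 - x * g11) - x * y * g10 - x * (y * g11 - x * g02)
      - x * y * g01 := by
    simp only [h00, Derivation.leibniz, smul_eq_mul, map_sub, h10, h01, hx, hEy]
    ring
  have e3 : E (E (E g00)) = y ^ 3 * g30 - 3 * x * y ^ 2 * g21 + 3 * x ^ 2 * y * g12 - x ^ 3 * g03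
      - 3 * x * y ^ 2 * g20 + 3 * x * y * (x - y) * g11 + 3 * x ^ 2 * y * g02
      - x * y * (y - x) * (g10 + g01) := by
    simp only [e2, Derivation.leibniz, smul_eq_mul, map_sub, h10, h01, h20, h11, h02, hx, hEy]
    ring
  rw [e3, e2, h00]
  subst hq hy
  -- The first two multipliers are forced by the terms 4 y³ g30 and -4 x³ g03 of 4 E³ g00; `r3`
  -- absorbs the remaining mixed moments.
  linear_combination 2 * (1 - x) ^ 2 * r1 - 2 * x ^ 2 * r2 - 2 * r3

/-- Reduction to one variable of the system for `F^{1:2;2}_{2:0;0}` on the curve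
`(1 - x) y = -x`. -/
theorem restrict_curve_ode {x y c k l g00 g10 g01 g20 g11 g02 g30 g21 g12 g03 : R}
    (hy : (1 - x) * y = -x) (hx : E x = x * (1 - x))
    (h00 : E g00 = (1 - x) * g10 + g01)
    (h10 : E g10 = (1 - x) * g20 + g11) (h01 : E g01 = (1 - x) * g11 + g02)
    (h20 : E g20 = (1 - x) * g30 + g21) (h11 : E g11 = (1 - x) * g21 + g12)
    (h02 : E g02 = (1 - x) * g12 + g03)
    (r1 : 8 * (g30 + 2 * g21 + g12 - (c - 1) ^ 2 * g10) =
      x * (8 * (g30 + g21) + 12 * g20 + 8 * g11 + (4 + 2 * k) * g10 + 2 * k * g01 + k * g00))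
    (r2 : 8 * (g03 + 2 * g12 + g21 - (c - 1) ^ 2 * g01) =
      y * (8 * (g03 + g12) + 12 * g02 + 8 * g11 + (4 + 2 * l) * g01 + 2 * l * g10 + l * g00))
    (r3 : y * (4 * (g12 + g11) + l * g10) = x * (4 * (g21 + g11) + k * g01)) :
    8 * E (E (E g00)) = -(12 * x) * E (E g00) +
      (2 * k * x * (1 - x) + 8 * (c - 1) ^ 2 * (1 - x) - 4 * x - 2 * x * l) * E g00 +
      (k * x * (1 - x) ^ 2 - x * l) * g00 := by
  have hE1 : E (1 - x) = -(x * (1 - x)) := by rw [map_sub, hx]; simp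
  have e2 : E (E g00) = (1 - x) ^ 2 * g20 + 2 * (1 - x) * g11 + g02 - x * (1 - x) * g10 := by
    simp only [h00, Derivation.leibniz, smul_eq_mul, map_add, h10, h01, hE1]
    ring
  have e3 : E (E (E g00)) = (1 - x) ^ 3 * g30 + 3 * (1 - x) ^ 2 * g21 + 3 * (1 - x) * g12 + g03
      - 3 * x * (1 - x) ^ 2 * g20 - 3 * x * (1 - x) * g11 - x * (1 - x) * (1 - 2 * x) * g10 := by
    simp only [e2, Derivation.leibniz, smul_eq_mul, map_add, map_sub, h10, h20, h11, h02, hx,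
      pow_two, Derivation.leibniz, Derivation.map_one_eq_zero, two_mul]
    ring
  have r2' : 8 * (1 - x) * (g03 + 2 * g12 + g21 - (c - 1) ^ 2 * g01) =
      -x * (8 * (g03 + g12) + 12 * g02 + 8 * g11 + (4 + 2 * l) * g01 + 2 * l * g10 + l * g00) := by
    linear_combination (1 - x) * r2 + (8 * (g03 + g12) + 12 * g02 + 8 * g11 + (4 + 2 * l) * g01 +
      2 * l * g10 + l * g00) * hy
  have r3' : -x * (4 * (g12 + g11) + l * g10) = x * (1 - x) * (4 * (g21 + g11) + k * g01) := by
    linear_combination (1 - x) * r3 - (4 * (g12 + g11) + l * g10) * hy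
  rw [e3, e2, h00]
  -- Again the pure moments g30 and g03 in 8 E³ g00 fix the multipliers of `r1` and `r2'`.
  linear_combination (1 - x) ^ 2 * r1 + r2' + 2 * x * r3'

/-- The third order equation for a product `w * f * g` of two hypergeometric solutions with
complementary exponents at the origin and a power `w` of `1 - x`. -/
theorem product_ode {x a b c w f g : R} (hx : E x = x * (1 - x))
    (ha : E a = 0) (hb : E b = 0) (hc : E c = 0)
    (hw : 2 * E w = (2 * (c - a - b) - 1) * x * w)
    (hf : E (E f) = -(c - 1 + (1 - a - b) * x) * E f + a * b * x * (1 - x) * f)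
    (hg : E (E g) = -(1 - c + (2 * c - 1 - a - b) * x) * E g +
      (1 + a - c) * (1 + b - c) * x * (1 - x) * g) :
    8 * E (E (E (w * (f * g)))) = -(12 * x) * E (E (w * (f * g))) +
      (2 * (1 - 4 * (a - b) ^ 2) * x * (1 - x) + 8 * (c - 1) ^ 2 * (1 - x) - 4 * x -
        2 * x * (1 - 4 * (a + b - c) ^ 2)) * E (w * (f * g)) +
      ((1 - 4 * (a - b) ^ 2) * x * (1 - x) ^ 2 - x * (1 - 4 * (a + b - c) ^ 2)) *
        (w * (f * g)) := by
  have h2 : E (2 : R) = 0 := by simpa using E.map_natCast 2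
  have hw2 : 4 * E (E w) = (2 * (c - a - b) - 1) * x *
      (2 * (1 - x) + (2 * (c - a - b) - 1) * x) * w := by
    have h := congrArg E hw
    simp only [Derivation.leibniz, smul_eq_mul, map_sub, Derivation.map_one_eq_zero,
      h2, ha, hb, hc, hx] at h
    linear_combination 2 * h + (2 * (c - a - b) - 1) * x * hw
  have hw3 : 8 * E (E (E w)) = (2 * (c - a - b) - 1) * x *
      ((2 * (1 - x) + (2 * (c - a - b) - 1) * x) ^ 2 + 2 * (2 * (c - a - b) - 1) * x * (1 - x) -
        4 * x * (1 - x)) * w := by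
    have h := congrArg E hw2
    have h4 : E (4 : R) = 0 := by simpa using E.map_natCast 4
    simp only [Derivation.leibniz, smul_eq_mul, map_add, map_sub, Derivation.map_one_eq_zero,
      h2, h4, ha, hb, hc, hx] at h
    linear_combination 2 * h + (2 * (c - a - b) - 1) * x *
      (2 * (1 - x) + (2 * (c - a - b) - 1) * x) * hw
  have hfg : E (E (f * g)) = E (E f) * g + 2 * (E f * E g) + f * E (E g) := by
    simp only [Derivation.leibniz, smul_eq_mul, map_add]
    ring
  have hfg1 : E (f * g) = E f * g + f * E g := by
    simp only [Derivation.leibniz, smul_eq_mul]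
    ring
  have hP : 8 * E (E (E (w * (f * g)))) = 8 * E (E (E w)) * (f * g) +
      24 * E (E w) * E (f * g) + 24 * E w * E (E (f * g)) + 8 * w * E (E (E (f * g))) := by
    simp only [Derivation.leibniz, smul_eq_mul, map_add]
    ring
  have hP2 : E (E (w * (f * g))) = E (E w) * (f * g) + 2 * E w * E (f * g) +
      w * E (E (f * g)) := by
    simp only [Derivation.leibniz, smul_eq_mul, map_add]
    ring
  have hP1 : E (w * (f * g)) = E w * (f * g) + w * E (f * g) := by
    simp only [Derivation.leibniz, smul_eq_mul]
    ring
  have hf3 := congrArg E hf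
  have hg3 := congrArg E hg
  simp only [Derivation.leibniz, smul_eq_mul, map_add, map_sub, map_neg,
    Derivation.map_one_eq_zero, h2, ha, hb, hc, hx] at hf3 hg3
  have hfg3 : E (E (E (f * g))) = E (E (E f)) * g + 3 * (E (E f) * E g) +
      3 * (E f * E (E g)) + f * E (E (E g)) := by
    simp only [Derivation.leibniz, smul_eq_mul, map_add]
    ring
  rw [hP, hP2, hP1, hfg3, hf3, hg3, hfg, hfg1, hf, hg]
  -- With f and g already reduced to first order, the derivatives of w are eliminated from the
  -- highest down: E³w, E²w, Ew.
  linear_combination (f * g) * hw3 + (6 * (E f * g + f * E g) + 3 * x * (f * g)) * hw2 +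
    (12 * ((-(c - 1 + (1 - a - b) * x) * E f + a * b * x * (1 - x) * f) * g + 2 * (E f * E g) +
        f * (-(1 - c + (2 * c - 1 - a - b) * x) * E g +
          (1 + a - c) * (1 + b - c) * x * (1 - x) * g)) +
      12 * x * (E f * g + f * E g) -
      ((1 - 4 * (a - b) ^ 2) * x * (1 - x) + 4 * (c - 1) ^ 2 * (1 - x) - 2 * x -
        x * (1 - 4 * (a + b - c) ^ 2)) * (f * g)) * hw

end AbstractODE

/-! ### Formal power series: lowest and top terms, uniqueness by exponents, the Gauss equation. -/

open PowerSeries in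
/-- The derivation `X (1 - X) d/dX` of `ℂ⟦X⟧`. -/
noncomputable def eulerD : Derivation ℂ (PowerSeries ℂ) (PowerSeries ℂ) :=
  (X * (1 - X) : PowerSeries ℂ) • PowerSeries.derivative ℂ

section FormalODE

open PowerSeries

theorem eulerD_apply (f : ℂ⟦X⟧) : eulerD f = X * (1 - X) * derivative ℂ f := rfl

@[simp] theorem eulerD_C (a : ℂ) : eulerD (C a) = 0 := by
  simp [eulerD_apply]

theorem eulerD_X : eulerD (X : ℂ⟦X⟧) = X * (1 - X) := by
  simp [eulerD_apply]

theorem eulerD_mk (f : ℕ → ℂ) :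
    eulerD (mk f) = (1 - X) * mk (fun n => (n : ℂ) * f n) := by
  have : X * derivative ℂ (mk f) = mk (fun n => (n : ℂ) * f n) := by
    ext n
    cases n with
    | zero => simp
    | succ n => simp [coeff_succ_X_mul, coeff_derivative, mul_comm]
  rw [eulerD_apply, ← this]
  ring

/-- `f` has order at least `n`, with coefficient `k` in degree `n`. -/
def LowAt (n : ℕ) (f : ℂ⟦X⟧) (k : ℂ) : Prop := (∀ i < n, coeff i f = 0) ∧ coeff n f = k

/-- `f` has degree at most `n`, with coefficient `k` in degree `n`. -/
def TopAt (n : ℕ) (f : ℂ⟦X⟧) (k : ℂ) : Prop := (∀ i, n < i → coeff i f = 0) ∧ coeff n f = k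

namespace LowAt

variable {n m : ℕ} {f g : ℂ⟦X⟧} {k l : ℂ}

theorem add (hf : LowAt n f k) (hg : LowAt n g l) : LowAt n (f + g) (k + l) :=
  ⟨fun i hi => by simp [hf.1 i hi, hg.1 i hi], by simp [hf.2, hg.2]⟩

theorem sub (hf : LowAt n f k) (hg : LowAt n g l) : LowAt n (f - g) (k - l) :=
  ⟨fun i hi => by simp [hf.1 i hi, hg.1 i hi], by simp [hf.2, hg.2]⟩

theorem mul (hf : LowAt n f k) (hg : LowAt m g l) : LowAt (n + m) (f * g) (k * l) := by
  constructor
  · intro i hi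
    rw [coeff_mul]
    refine Finset.sum_eq_zero fun p hp => ?_
    rw [Finset.HasAntidiagonal.mem_antidiagonal] at hp
    rcases lt_or_ge p.1 n with h | h
    · rw [hf.1 _ h, zero_mul]
    · rw [hg.1 p.2 (by omega), mul_zero]
  · rw [coeff_mul, Finset.sum_eq_single (n, m)]
    · simp [hf.2, hg.2]
    · rintro ⟨i, j⟩ hp hne
      rw [Finset.HasAntidiagonal.mem_antidiagonal] at hp
      rcases lt_trichotomy i n with h | h | h
      · simp [hf.1 _ h]
      · exact absurd (Prod.ext h (by simp at hp; omega)) hne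
      · simp at hp
        simp [hg.1 j (by omega)]
    · simp

theorem of_coeff_zero (f : ℂ⟦X⟧) : LowAt 0 f (coeff 0 f) := ⟨by simp, rfl⟩

theorem const (a : ℂ) : LowAt 0 (C a) a := ⟨by simp, by simp⟩

theorem const_mul (a : ℂ) (hf : LowAt n f k) : LowAt n (C a * f) (a * k) := by
  simpa using (const a).mul hf

theorem eulerD (hf : LowAt n f k) : LowAt n (eulerD f) (n * k) := by
  have h : f = mk (fun i => coeff i f) := by ext; simp
  rw [h, eulerD_mk]
  have : LowAt n (mk (fun i => (i : ℂ) * coeff i f)) (n * k) :=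
    ⟨fun i hi => by simp [hf.1 i hi], by simp [hf.2]⟩
  have h1 : LowAt 0 (1 - X : ℂ⟦X⟧) 1 := ⟨by simp, by simp⟩
  simpa using h1.mul this

theorem X_pow (n : ℕ) : LowAt n (X ^ n : ℂ⟦X⟧) 1 :=
  ⟨fun i hi => by simp [coeff_X_pow, hi.ne], by simp [coeff_X_pow]⟩

theorem mono (hf : LowAt n f k) (h : m < n) : LowAt m f 0 :=
  ⟨fun i hi => hf.1 i (hi.trans h), hf.1 m h⟩

end LowAt

namespace TopAt

variable {n m : ℕ} {f g : ℂ⟦X⟧} {k l : ℂ}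

theorem add (hf : TopAt n f k) (hg : TopAt n g l) : TopAt n (f + g) (k + l) :=
  ⟨fun i hi => by simp [hf.1 i hi, hg.1 i hi], by simp [hf.2, hg.2]⟩

theorem sub (hf : TopAt n f k) (hg : TopAt n g l) : TopAt n (f - g) (k - l) :=
  ⟨fun i hi => by simp [hf.1 i hi, hg.1 i hi], by simp [hf.2, hg.2]⟩

theorem mul (hf : TopAt n f k) (hg : TopAt m g l) : TopAt (n + m) (f * g) (k * l) := by
  constructor
  · intro i hi
    rw [coeff_mul]
    refine Finset.sum_eq_zero fun p hp => ?_
    rw [Finset.HasAntidiagonal.mem_antidiagonal] at hp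
    rcases lt_or_ge n p.1 with h | h
    · rw [hf.1 _ h, zero_mul]
    · rw [hg.1 p.2 (by omega), mul_zero]
  · rw [coeff_mul, Finset.sum_eq_single (n, m)]
    · simp [hf.2, hg.2]
    · rintro ⟨i, j⟩ hp hne
      rw [Finset.HasAntidiagonal.mem_antidiagonal] at hp
      rcases lt_trichotomy i n with h | h | h
      · simp at hp
        simp [hg.1 j (by omega)]
      · exact absurd (Prod.ext h (by simp at hp; omega)) hne
      · simp [hf.1 _ h]
    · simp

theorem const (a : ℂ) : TopAt 0 (C a) a := ⟨fun i hi => by simp [coeff_C, hi.ne'], by simp⟩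

theorem const_mul (a : ℂ) (hf : TopAt n f k) : TopAt n (C a * f) (a * k) := by
  simpa using (const a).mul hf

theorem X_pow (n : ℕ) : TopAt n (X ^ n : ℂ⟦X⟧) 1 :=
  ⟨fun i hi => by simp [coeff_X_pow, hi.ne'], by simp [coeff_X_pow]⟩

theorem C_add_C_mul_X (a b : ℂ) : TopAt 1 (C a + C b * X) b :=
  ⟨fun i hi => by simp [coeff_C, coeff_X, hi.ne', (zero_lt_one.trans hi).ne'], by simp [coeff_C]⟩

theorem one_sub_X : TopAt 1 (1 - X : ℂ⟦X⟧) (-1) := by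
  convert C_add_C_mul_X 1 (-1) using 1
  simp [sub_eq_add_neg]

theorem one_sub_X_pow (n : ℕ) : TopAt n ((1 - X) ^ n : ℂ⟦X⟧) ((-1) ^ n) := by
  induction n with
  | zero => simpa using const 1
  | succ n ih => rw [pow_succ, pow_succ]; exact ih.mul one_sub_X

/-- Because E X^n = n X^n - n X^(n+1), the derivation keeps the order but raises the degree by one,
with a sign. -/
theorem eulerD (hf : TopAt n f k) : TopAt (n + 1) (eulerD f) (-(n * k)) := by
  have h : f = mk (fun i => coeff i f) := by ext; simp
  rw [h, eulerD_mk]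
  have : TopAt n (mk (fun i => (i : ℂ) * coeff i f)) (n * k) :=
    ⟨fun i hi => by simp [hf.1 i hi], by simp [hf.2]⟩
  have h2 := one_sub_X.mul this
  rwa [neg_one_mul, add_comm] at h2

theorem mono (hf : TopAt n f k) (h : n < m) : TopAt m f 0 :=
  ⟨fun i hi => hf.1 i (h.trans hi), hf.1 m h⟩

end TopAt

/-- A formal solution of a third order equation in `X (1 - X) d/dX` vanishes as soon as its
constant coefficient and its coefficients at the positive integer exponents do. -/
theorem eq_zero_of_third_order {Y r₂ r₁ r₀ : ℂ⟦X⟧}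
    (h : eulerD (eulerD (eulerD Y)) = r₂ * eulerD (eulerD Y) + r₁ * eulerD Y + r₀ * Y)
    (h0 : ∀ n : ℕ, (n : ℂ) ^ 3 = coeff 0 r₂ * n ^ 2 + coeff 0 r₁ * n + coeff 0 r₀ →
      coeff n Y = 0) : Y = 0 := by
  ext n
  induction n using Nat.strong_induction_on with
  | _ n ih =>
    by_contra hne
    refine hne (h0 n ?_)
    -- If all lower coefficients vanish, comparing degree n on both sides gives the indicial
    -- polynomial at n times the coefficient.
    have hY : LowAt n Y (coeff n Y) := ⟨fun i hi => by simpa using ih i hi, rfl⟩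
    have h1 := hY.eulerD.eulerD.eulerD
    have h2 := (((LowAt.of_coeff_zero r₂).mul hY.eulerD.eulerD).add
      ((LowAt.of_coeff_zero r₁).mul hY.eulerD)).add ((LowAt.of_coeff_zero r₀).mul hY)
    rw [h] at h1
    rw [zero_add] at h2
    have h3 := h1.2.symm.trans h2.2
    have h4 : coeff n Y ≠ 0 := by simpa using hne
    apply mul_right_cancel₀ h4
    linear_combination h3

theorem eq_zero_of_first_order {Y r : ℂ⟦X⟧} (h : eulerD Y = r * Y)
    (h0 : ∀ n : ℕ, (n : ℂ) = coeff 0 r → coeff n Y = 0) : Y = 0 := by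
  ext n
  induction n using Nat.strong_induction_on with
  | _ n ih =>
    by_contra hne
    refine hne (h0 n ?_)
    have hY : LowAt n Y (coeff n Y) := ⟨fun i hi => by simpa using ih i hi, rfl⟩
    have h1 := hY.eulerD
    have h2 := (LowAt.of_coeff_zero r).mul hY
    rw [h] at h1
    rw [zero_add] at h2
    exact mul_right_cancel₀ (by simpa using hne) (h1.2.symm.trans h2.2)

/-- The formal Gauss hypergeometric series. -/
noncomputable def hypSeries (a b c : ℂ) : ℂ⟦X⟧ :=
  mk fun k => poch a k * poch b k / (poch c k * k.factorial)

theorem poch_succ (a : ℂ) (k : ℕ) : poch a (k + 1) = poch a k * (a + k) := by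
  simp [poch, ascPochhammer_succ_right]

@[simp] theorem poch_zero (a : ℂ) : poch a 0 = 1 := by simp [poch]

theorem poch_ne_zero {a : ℂ} {k : ℕ} (h : ∀ i < k, a + i ≠ 0) : poch a k ≠ 0 := by
  induction k with
  | zero => simp
  | succ k ih =>
    rw [poch_succ]
    exact mul_ne_zero (ih fun i hi => h i (by omega)) (h k (by omega))

theorem add_ne_zero_of_ne_neg {c : ℂ} (h : ∀ k : ℕ, c ≠ -(k : ℂ)) (k : ℕ) : c + k ≠ 0 :=
  fun h0 => h k (eq_neg_of_add_eq_zero_left h0)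

theorem coeff_hypSeries_succ {a b c : ℂ} (hc : ∀ k : ℕ, c + k ≠ 0) (k : ℕ) :
    coeff (k + 1) (hypSeries a b c) * ((c + k) * (k + 1)) =
      (a + k) * (b + k) * coeff k (hypSeries a b c) := by
  have h1 : poch c k ≠ 0 := poch_ne_zero fun i _ => hc i
  have h2 : (k.factorial : ℂ) ≠ 0 := by exact_mod_cast k.factorial_ne_zero
  have h3 : (k + 1 : ℂ) ≠ 0 := by exact_mod_cast k.succ_ne_zero
  have h4 := hc k
  simp only [hypSeries, coeff_mk, poch_succ, Nat.factorial_succ, Nat.cast_mul, Nat.cast_add,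
    Nat.cast_one]
  field_simp

@[simp] theorem coeff_zero_hypSeries (a b c : ℂ) : coeff 0 (hypSeries a b c) = 1 := by
  simp [hypSeries]

@[simp] theorem constantCoeff_hypSeries (a b c : ℂ) : constantCoeff (hypSeries a b c) = 1 := by
  rw [← coeff_zero_eq_constantCoeff, coeff_zero_hypSeries]

theorem hypSeries_ode {a b c : ℂ} (hc : ∀ k : ℕ, c + k ≠ 0) :
    eulerD (eulerD (hypSeries a b c)) =
      -(C c - 1 + (1 - C a - C b) * X) * eulerD (hypSeries a b c) +
        C a * C b * X * (1 - X) * hypSeries a b c := by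
  set F := fun k => coeff k (hypSeries a b c) with hF
  have hFm : hypSeries a b c = mk F := by ext; simp [hF]
  -- With θ = X d/dX this is θ(θ+c-1)F = X(θ+a)(θ+b)F; the equation for E = (1-X)θ is its multiple
  -- by 1-X.
  have hrec : mk (fun n => (n : ℂ) * (n * F n)) + (C c - 1) * mk (fun n => (n : ℂ) * F n) =
      X * (mk (fun n => (n : ℂ) * (n * F n)) + (C a + C b) * mk (fun n => (n : ℂ) * F n) +
        C a * C b * mk F) := by
    have e1 : mk (fun n => (n : ℂ) * (n * F n)) + (C c - 1) * mk (fun n => (n : ℂ) * F n) =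
        mk (fun n => (n : ℂ) * (n + c - 1) * F n) := by
      ext n
      simp only [sub_mul, map_add, map_sub, coeff_C_mul, coeff_mk, one_mul]
      ring
    have e2 : mk (fun n => (n : ℂ) * (n * F n)) + (C a + C b) * mk (fun n => (n : ℂ) * F n) +
        C a * C b * mk F = mk (fun n => (a + n) * (b + n) * F n) := by
      ext n
      simp only [add_mul, map_add, coeff_C_mul, coeff_mk, mul_assoc]
      ring
    rw [e1, e2]
    ext n
    cases n with
    | zero => simp
    | succ n =>
      rw [coeff_succ_X_mul, coeff_mk, coeff_mk, ← coeff_hypSeries_succ hc]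
      push_cast
      ring
  rw [hFm]
  have hX1 : eulerD (1 - X : ℂ⟦X⟧) = -(X * (1 - X)) := by rw [map_sub, eulerD_X]; simp
  rw [eulerD_mk, Derivation.leibniz, eulerD_mk, hX1, smul_eq_mul, smul_eq_mul]
  linear_combination (1 - X) * hrec

end FormalODE

/-! ### Moments of coefficient arrays with finitely many columns, and the line x + y = 1. -/

section Arrays

open PowerSeries

/-- The partial sum `∑_{j < N} y ^ j ∑_i A i j X ^ i`. -/
noncomputable def colSum (y : ℂ⟦X⟧) (N : ℕ) : (ℕ → ℕ → ℂ) →ₗ[ℂ] ℂ⟦X⟧ where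
  toFun A := ∑ j ∈ Finset.range N, y ^ j * mk fun i => A i j
  map_add' A B := by
    rw [← Finset.sum_add_distrib]
    refine Finset.sum_congr rfl fun j _ => ?_
    rw [← mul_add]
    congr 1
  map_smul' r A := by
    rw [RingHom.id_apply, Finset.smul_sum]
    refine Finset.sum_congr rfl fun j _ => ?_
    rw [← mul_smul_comm]
    congr 1

theorem colSum_apply (y : ℂ⟦X⟧) (N : ℕ) (A : ℕ → ℕ → ℂ) :
    colSum y N A = ∑ j ∈ Finset.range N, y ^ j * mk fun i => A i j := rfl

/-- The array `i ^ s * j ^ t * A i j`. -/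
def momentArray (A : ℕ → ℕ → ℂ) (s t : ℕ) (i j : ℕ) : ℂ := (i : ℂ) ^ s * (j : ℂ) ^ t * A i j

/-- The chain rule, with e the logarithmic E-derivative of y: it is -X for y = 1-X and 1 for y =
X/(X-1). -/
theorem eulerD_colSum {y e : ℂ⟦X⟧} (hy : eulerD y = e * y) (N : ℕ) (A : ℕ → ℕ → ℂ) (s t : ℕ) :
    eulerD (colSum y N (momentArray A s t)) =
      (1 - X) * colSum y N (momentArray A (s + 1) t) +
        e * colSum y N (momentArray A s (t + 1)) := by
  have hp (j : ℕ) : eulerD (y ^ j) = e * (C (j : ℂ) * y ^ j) := by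
    induction j with
    | zero => simp
    | succ j ih =>
      rw [pow_succ, Derivation.leibniz, ih, hy, smul_eq_mul, smul_eq_mul]
      push_cast
      rw [map_add, map_one]
      ring
  simp only [colSum_apply, map_sum, Finset.mul_sum]
  rw [← Finset.sum_add_distrib]
  refine Finset.sum_congr rfl fun j _ => ?_
  rw [Derivation.leibniz, hp, eulerD_mk, smul_eq_mul, smul_eq_mul]
  have h1 : (mk fun i => momentArray A s (t + 1) i j) =
      C (j : ℂ) * mk fun i => momentArray A s t i j := by
    ext i
    simp only [coeff_C_mul, coeff_mk, momentArray]
    ring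
  have h2 : (mk fun i => momentArray A (s + 1) t i j) =
      mk fun i => (i : ℂ) * momentArray A s t i j := by
    ext i
    simp only [coeff_mk, momentArray]
    ring
  rw [h1, h2]
  ring

theorem colSum_shift_fst {y : ℂ⟦X⟧} {N : ℕ} {B D : ℕ → ℕ → ℂ} (h0 : ∀ j, B 0 j = 0)
    (h : ∀ i j, B (i + 1) j = D i j) : colSum y N B = X * colSum y N D := by
  simp only [colSum_apply, Finset.mul_sum]
  refine Finset.sum_congr rfl fun j _ => ?_
  have : (mk fun i => B i j) = X * mk fun i => D i j := by
    ext i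
    cases i with
    | zero => simp [h0]
    | succ i => simp [coeff_succ_X_mul, h]
  rw [this]
  ring

/-- Shifting j uses up one column, hence N+1 against N. For y = 1-X, which is a unit, there is no
X-adic limit in j, so the number of columns must be tracked. -/
theorem colSum_shift_snd {y : ℂ⟦X⟧} {N : ℕ} {B D : ℕ → ℕ → ℂ} (h0 : ∀ i, B i 0 = 0)
    (h : ∀ i j, B i (j + 1) = D i j) : colSum y (N + 1) B = y * colSum y N D := by
  simp only [colSum_apply, Finset.mul_sum]
  rw [Finset.sum_range_succ']
  have : (mk fun i => B i 0) = 0 := by ext; simp [h0]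
  rw [this, mul_zero, add_zero]
  refine Finset.sum_congr rfl fun j _ => ?_
  simp only [h]
  ring

theorem colSum_succ_of_zero {y : ℂ⟦X⟧} {N : ℕ} {B : ℕ → ℕ → ℂ} (h0 : ∀ i, B i N = 0) :
    colSum y (N + 1) B = colSum y N B := by
  simp only [colSum_apply]
  rw [Finset.sum_range_succ]
  have : (mk fun i => B i N) = 0 := by ext; simp [h0]
  rw [this, mul_zero, add_zero]

/-- The first coefficient recurrence of `F^{2:1;1}_{1:1;1}`, as an identity of moments. -/
theorem line_array_left (A : ℕ → ℕ → ℂ) (α β p : ℂ) :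
    (fun i j => (i : ℂ) * (i + p - 1) * (2 * i + 2 * j + α + β - 1) * A i j : ℕ → ℕ → ℂ) =
    (2 : ℂ) • (momentArray A 3 0 + momentArray A 2 1) +
      (α + β + 2 * p - 3) • momentArray A 2 0 + (2 * (p - 1)) • momentArray A 1 1 +
        ((p - 1) * (α + β - 1)) • momentArray A 1 0 := by
  funext i j
  simp only [Pi.add_apply, Pi.smul_apply, smul_eq_mul, momentArray]
  ring

theorem line_array_right (A : ℕ → ℕ → ℂ) (α β p : ℂ) :
    (fun i j => (α + i + j) * (β + i + j) * (p + 2 * i) * A i j : ℕ → ℕ → ℂ) =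
    (2 : ℂ) • (momentArray A 3 0 + (2 : ℂ) • momentArray A 2 1 + momentArray A 1 2) +
      (p + 2 * (α + β)) • momentArray A 2 0 + (2 * (p + α + β)) • momentArray A 1 1 +
      p • momentArray A 0 2 + (p * (α + β) + 2 * α * β) • momentArray A 1 0 +
      (p * (α + β)) • momentArray A 0 1 + (p * α * β) • momentArray A 0 0 := by
  funext i j
  simp only [Pi.add_apply, Pi.smul_apply, smul_eq_mul, momentArray]
  ring

theorem line_array_left' (A : ℕ → ℕ → ℂ) (α β q : ℂ) :
    (fun i j => (j : ℂ) * (j + q - 1) * (2 * i + 2 * j + α + β - 1) * A i j : ℕ → ℕ → ℂ) =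
    (2 : ℂ) • (momentArray A 0 3 + momentArray A 1 2) +
      (α + β + 2 * q - 3) • momentArray A 0 2 + (2 * (q - 1)) • momentArray A 1 1 +
        ((q - 1) * (α + β - 1)) • momentArray A 0 1 := by
  funext i j
  simp only [Pi.add_apply, Pi.smul_apply, smul_eq_mul, momentArray]
  ring

theorem line_array_right' (A : ℕ → ℕ → ℂ) (α β q : ℂ) :
    (fun i j => (α + i + j) * (β + i + j) * (q + 2 * j) * A i j : ℕ → ℕ → ℂ) =
    (2 : ℂ) • (momentArray A 0 3 + (2 : ℂ) • momentArray A 1 2 + momentArray A 2 1) +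
      (q + 2 * (α + β)) • momentArray A 0 2 + (2 * (q + α + β)) • momentArray A 1 1 +
      q • momentArray A 2 0 + (q * (α + β) + 2 * α * β) • momentArray A 0 1 +
      (q * (α + β)) • momentArray A 1 0 + (q * α * β) • momentArray A 0 0 := by
  funext i j
  simp only [Pi.add_apply, Pi.smul_apply, smul_eq_mul, momentArray]
  ring

/-- One side of the relation left when the factors depending only on i+j are eliminated between the
two recurrences. -/
theorem line_array_cross (A : ℕ → ℕ → ℂ) (p q : ℂ) :
    (fun i j => (i : ℂ) * (i + p - 1) * (q + 2 * j) * A i j : ℕ → ℕ → ℂ) =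
    (2 : ℂ) • momentArray A 2 1 + q • momentArray A 2 0 +
      (2 * (p - 1)) • momentArray A 1 1 + (q * (p - 1)) • momentArray A 1 0 := by
  funext i j
  simp only [Pi.add_apply, Pi.smul_apply, smul_eq_mul, momentArray]
  ring

theorem line_array_cross' (A : ℕ → ℕ → ℂ) (p q : ℂ) :
    (fun i j => (j : ℂ) * (j + q - 1) * (p + 2 * i) * A i j : ℕ → ℕ → ℂ) =
    (2 : ℂ) • momentArray A 1 2 + p • momentArray A 0 2 +
      (2 * (q - 1)) • momentArray A 1 1 + (p * (q - 1)) • momentArray A 0 1 := by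
  funext i j
  simp only [Pi.add_apply, Pi.smul_apply, smul_eq_mul, momentArray]
  ring

/-- A double series of type `F^{2:1;1}_{1:1;1}` with `j ≤ n`, restricted to the line `x + y = 1`,
satisfies the symmetric square of a Gauss hypergeometric equation. -/
theorem line_symSq {a b p q : ℂ} {n : ℕ} {A : ℕ → ℕ → ℂ} (hq : q = a + b - p)
    (hc : ∀ k : ℕ, a + b + 1 / 2 + k ≠ 0) (hA : ∀ i j, n < j → A i j = 0)
    (h1 : ∀ i j, A (i + 1) j * ((a + b + 1 / 2 + (i + j : ℕ)) * (2 * p + i) * (i + 1)) =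
      (2 * a + (i + j : ℕ)) * (2 * b + (i + j : ℕ)) * (p + i) * A i j)
    (h2 : ∀ i j, A i (j + 1) * ((a + b + 1 / 2 + (i + j : ℕ)) * (2 * q + j) * (j + 1)) =
      (2 * a + (i + j : ℕ)) * (2 * b + (i + j : ℕ)) * (q + j) * A i j)
    {u v Y : ℂ⟦X⟧} (hu : u = -(C (p - 1 / 2) + C (1 - a - b) * X))
    (hv : v = C (a * b) * (X * (1 - X))) (hY : Y = colSum (1 - X) (n + 2) A) :
    eulerD (eulerD (eulerD Y)) = 3 * u * eulerD (eulerD Y) +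
      (4 * v + eulerD u - 2 * u ^ 2) * eulerD Y + (2 * eulerD v - 4 * u * v) * Y := by
  set Φ := colSum (1 - X) (n + 2) with hΦ
  have hEy : eulerD (1 - X : ℂ⟦X⟧) = -X * (1 - X) := by rw [map_sub, eulerD_X]; simp
  have hE (s t : ℕ) := eulerD_colSum hEy (n + 2) A s t
  have hE' (s t : ℕ) : eulerD (Φ (momentArray A s t)) = (1 - X) * Φ (momentArray A (s + 1) t) -
      X * Φ (momentArray A s (t + 1)) := by rw [hE]; ring
  have h00 : momentArray A 0 0 = A := by funext i j; simp [momentArray]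
  have r1 : Φ (fun i j => (i : ℂ) * (i + 2 * p - 1) * (2 * i + 2 * j + 2 * a + 2 * b - 1) * A i j)
      = X * Φ (fun i j => (2 * a + i + j) * (2 * b + i + j) * (2 * p + 2 * i) * A i j) := by
    refine colSum_shift_fst (by simp) fun i j => ?_
    have := h1 i j
    push_cast at this ⊢
    linear_combination 2 * this
  have r2 : Φ (fun i j => (j : ℂ) * (j + 2 * q - 1) * (2 * i + 2 * j + 2 * a + 2 * b - 1) * A i j)
      = (1 - X) *
        Φ (fun i j => (2 * a + i + j) * (2 * b + i + j) * (2 * q + 2 * j) * A i j) := by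
    -- Column n+1 is zero. This spare column is the reason for summing n+2 of them: the shift in j
    -- leaves n+1 columns.
    rw [hΦ, colSum_succ_of_zero (B := fun i j => (2 * a + i + j) * (2 * b + i + j) *
      (2 * q + 2 * j) * A i j) fun i => by simp [hA]]
    refine colSum_shift_snd (by simp) fun i j => ?_
    have := h2 i j
    push_cast at this ⊢
    linear_combination 2 * this
  have hcross (i j : ℕ) : A (i + 1) j * ((2 * p + i) * (i + 1) * (q + j)) =
      A i (j + 1) * ((2 * q + j) * (j + 1) * (p + i)) := by
    apply mul_left_cancel₀ (hc (i + j))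
    linear_combination (q + j) * h1 i j - (p + i) * h2 i j
  have r3 : (1 - X) * Φ (fun i j => (i : ℂ) * (i + 2 * p - 1) * (2 * q + 2 * j) * A i j) =
      X * Φ (fun i j => (j : ℂ) * (j + 2 * q - 1) * (2 * p + 2 * i) * A i j) := by
    set D : ℕ → ℕ → ℂ := fun i j => 2 * (A i (j + 1) * ((2 * q + j) * (j + 1) * (p + i))) with hD
    have e1 : Φ (fun i j => (i : ℂ) * (i + 2 * p - 1) * (2 * q + 2 * j) * A i j) = X * Φ D := by
      refine colSum_shift_fst (by simp) fun i j => ?_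
      rw [hD]
      push_cast
      linear_combination 2 * hcross i j
    have e2 : Φ (fun i j => (j : ℂ) * (j + 2 * q - 1) * (2 * p + 2 * i) * A i j) =
        (1 - X) * Φ D := by
      rw [hΦ, colSum_succ_of_zero (B := D) fun i => by simp [hD, hA]]
      refine colSum_shift_snd (by simp) fun i j => ?_
      rw [hD]
      push_cast
      ring
    rw [e1, e2]
    ring
  have hC2 : (C (2 : ℂ) : ℂ⟦X⟧) = 2 := map_ofNat C 2
  have hC3 : (C (3 : ℂ) : ℂ⟦X⟧) = 3 := map_ofNat C 3
  have hC4 : (C (4 : ℂ) : ℂ⟦X⟧) = 4 := map_ofNat C 4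
  have l1 := line_array_left A (2 * a) (2 * b) (2 * p)
  have l1' := line_array_right A (2 * a) (2 * b) (2 * p)
  have l2 := line_array_left' A (2 * a) (2 * b) (2 * q)
  have l2' := line_array_right' A (2 * a) (2 * b) (2 * q)
  rw [l1, l1'] at r1
  rw [l2, l2'] at r2
  rw [line_array_cross, line_array_cross'] at r3
  simp only [map_add, map_smul, smul_eq_C_mul, map_mul, map_sub, hC2, hC3, map_one] at r1 r2 r3
  have hqC : 2 * (C q : ℂ⟦X⟧) = 2 * C a + 2 * C b - 2 * C p := by
    rw [hq, map_sub, map_add]; ring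
  -- The abstract parameters α, β, p, q are twice a, b, p, q; hence the factors 2 and 4 removed
  -- below.
  have key := restrict_line_ode eulerD rfl eulerD_X hqC (hE' 0 0) (hE' 1 0) (hE' 0 1)
    (hE' 2 0) (hE' 1 1) (hE' 0 2) (α := 2 * C a) (β := 2 * C b) (p := 2 * C p)
    (x := X) (y := 1 - X) (q := 2 * C q)
    (g30 := Φ (momentArray A 3 0)) (g21 := Φ (momentArray A 2 1))
    (g12 := Φ (momentArray A 1 2)) (g03 := Φ (momentArray A 0 3))
    (g20 := Φ (momentArray A 2 0)) (g11 := Φ (momentArray A 1 1))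
    (g02 := Φ (momentArray A 0 2)) (g10 := Φ (momentArray A 1 0))
    (g01 := Φ (momentArray A 0 1)) (g00 := Φ (momentArray A 0 0))
    (by linear_combination r1) (by linear_combination r2) (by linear_combination r3)
  rw [h00, ← hY] at key
  have hu2 : 2 * u = -(2 * C p - 1 + (2 - 2 * C a - 2 * C b) * X) := by
    have hh : (C (1 / 2 : ℂ) : ℂ⟦X⟧) * 2 = 1 := by
      rw [← hC2, ← map_mul]; norm_num
    rw [hu]
    simp only [map_sub, map_one]
    linear_combination hh
  have hu4 : 4 * u ^ 2 = (2 * C p - 1 + (2 - 2 * C a - 2 * C b) * X) ^ 2 := by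
    linear_combination (2 * u - (2 * C p - 1 + (2 - 2 * C a - 2 * C b) * X)) * hu2
  have hEu : eulerD u = -((1 - C a - C b) * (X * (1 - X))) := by
    rw [hu, map_neg, map_add, eulerD_C, Derivation.leibniz, eulerD_C, eulerD_X, smul_eq_mul]
    simp only [map_sub, map_one, smul_zero]
    ring
  have hEv : eulerD v = C a * C b * (X * (1 - X) * (1 - 2 * X)) := by
    rw [hv, Derivation.leibniz, Derivation.leibniz, eulerD_C, hEy, eulerD_X, map_mul]
    simp only [smul_eq_mul]
    ring
  have h4 : (4 : ℂ⟦X⟧) ≠ 0 := by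
    rw [← hC4, Ne, map_eq_zero_iff _ C_injective]; norm_num
  apply mul_left_cancel₀ h4
  rw [hEu, hEv]
  rw [map_mul] at hv
  linear_combination key - 6 * eulerD (eulerD Y) * hu2 + 2 * eulerD Y * hu4 -
    (16 * eulerD Y - 16 * u * Y) * hv + 8 * C a * C b * X * (1 - X) * Y * hu2

end Arrays

/-! ### Infinite double series on the curve y = x/(x-1), and the formal Chaundy identity. -/

section DoubleArrays

open PowerSeries

/-- The formal double series `∑_{i, j} A i j X ^ i y ^ j`, for `y` without constant term. -/
noncomputable def diagSum (y : ℂ⟦X⟧) : (ℕ → ℕ → ℂ) →ₗ[ℂ] ℂ⟦X⟧ where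
  toFun A := mk fun n => coeff n (colSum y (n + 1) A)
  map_add' A B := by ext n; simp
  map_smul' r A := by ext n; simp

/-- As X divides y, the columns j > n do not reach degree n. -/
theorem coeff_diagSum {y : ℂ⟦X⟧} (hy : X ∣ y) (A : ℕ → ℕ → ℂ) {n N : ℕ} (h : n < N) :
    coeff n (diagSum y A) = coeff n (colSum y N A) := by
  have h1 : coeff n (diagSum y A) = coeff n (colSum y (n + 1) A) := by simp [diagSum]
  rw [h1, colSum_apply, colSum_apply, map_sum, map_sum]
  refine Finset.sum_subset (fun j hj => by simp at hj ⊢; omega) fun j _ hj => ?_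
  have hj' : n < j := by simp at hj; omega
  exact X_pow_dvd_iff.1 (dvd_mul_of_dvd_left (pow_dvd_pow_of_dvd hy j) _) n hj'

theorem diagSum_eq_add {y : ℂ⟦X⟧} (hy : X ∣ y) (A : ℕ → ℕ → ℂ) (N : ℕ) :
    ∃ h, diagSum y A = colSum y N A + X ^ N * h := by
  have : X ^ N ∣ diagSum y A - colSum y N A := X_pow_dvd_iff.2 fun m hm => by
    rw [map_sub, coeff_diagSum hy A hm, sub_self]
  obtain ⟨h, hh⟩ := this
  exact ⟨h, by rw [← hh]; ring⟩

theorem eq_of_forall_X_pow_dvd {f g : ℂ⟦X⟧} (h : ∀ N, X ^ N ∣ f - g) : f = g := by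
  ext n
  have := X_pow_dvd_iff.1 (h (n + 1)) n (Nat.lt_succ_self n)
  rwa [map_sub, sub_eq_zero] at this

/-- E preserves the ideal (X^N), so it is X-adically continuous and the rule for finitely many
columns passes to the limit. -/
theorem X_pow_dvd_eulerD (N : ℕ) (h : ℂ⟦X⟧) : X ^ N ∣ eulerD (X ^ N * h) := by
  have hp : eulerD (X ^ N : ℂ⟦X⟧) = X ^ N * ((N : ℂ⟦X⟧) * (1 - X)) := by
    rw [Derivation.leibniz_pow, eulerD_X]
    cases N with
    | zero => simp
    | succ N =>
      simp only [smul_eq_mul, nsmul_eq_mul, Nat.add_sub_cancel]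
      ring
  rw [Derivation.leibniz, hp, smul_eq_mul, smul_eq_mul]
  exact dvd_add (dvd_mul_right _ _) (Dvd.intro _ (by ring : X ^ N * (h * ((N : ℂ⟦X⟧) * (1 - X))) =
    h * (X ^ N * ((N : ℂ⟦X⟧) * (1 - X)))))

theorem eulerD_diagSum {y e : ℂ⟦X⟧} (hX : X ∣ y) (hy : eulerD y = e * y) (A : ℕ → ℕ → ℂ)
    (s t : ℕ) :
    eulerD (diagSum y (momentArray A s t)) =
      (1 - X) * diagSum y (momentArray A (s + 1) t) +
        e * diagSum y (momentArray A s (t + 1)) := by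
  refine eq_of_forall_X_pow_dvd fun N => ?_
  obtain ⟨h0, e0⟩ := diagSum_eq_add hX (momentArray A s t) N
  obtain ⟨h1, e1⟩ := diagSum_eq_add hX (momentArray A (s + 1) t) N
  obtain ⟨h2, e2⟩ := diagSum_eq_add hX (momentArray A s (t + 1)) N
  obtain ⟨h3, e3⟩ := X_pow_dvd_eulerD N h0
  rw [e0, e1, e2, map_add, e3, eulerD_colSum hy]
  exact ⟨h3 - (1 - X) * h1 - e * h2, by ring⟩

theorem diagSum_shift_fst {y : ℂ⟦X⟧} (hX : X ∣ y) {B D : ℕ → ℕ → ℂ} (h0 : ∀ j, B 0 j = 0)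
    (h : ∀ i j, B (i + 1) j = D i j) : diagSum y B = X * diagSum y D := by
  refine eq_of_forall_X_pow_dvd fun N => ?_
  obtain ⟨h1, e1⟩ := diagSum_eq_add hX B N
  obtain ⟨h2, e2⟩ := diagSum_eq_add hX D N
  rw [e1, e2, colSum_shift_fst h0 h]
  exact ⟨h1 - X * h2, by ring⟩

theorem diagSum_shift_snd {y : ℂ⟦X⟧} (hX : X ∣ y) {B D : ℕ → ℕ → ℂ} (h0 : ∀ i, B i 0 = 0)
    (h : ∀ i j, B i (j + 1) = D i j) : diagSum y B = y * diagSum y D := by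
  refine eq_of_forall_X_pow_dvd fun N => ?_
  obtain ⟨h1, e1⟩ := diagSum_eq_add hX B (N + 1)
  obtain ⟨h2, e2⟩ := diagSum_eq_add hX D N
  rw [e1, e2, colSum_shift_snd h0 h]
  exact ⟨X * h1 - y * h2, by ring⟩

theorem curve_array_left (A : ℕ → ℕ → ℂ) (γ : ℂ) :
    (fun i j => 8 * (i * ((i + j) ^ 2 - γ)) * A i j : ℕ → ℕ → ℂ) =
    (8 : ℂ) • (momentArray A 3 0 + (2 : ℂ) • momentArray A 2 1 + momentArray A 1 2 -
      γ • momentArray A 1 0) := by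
  funext i j
  simp only [Pi.add_apply, Pi.sub_apply, Pi.smul_apply, smul_eq_mul, momentArray]
  ring

theorem curve_array_right (A : ℕ → ℕ → ℂ) (k : ℂ) :
    (fun i j => (1 + 2 * i + 2 * j) * (4 * i ^ 2 + 4 * i + k) * A i j : ℕ → ℕ → ℂ) =
    (8 : ℂ) • (momentArray A 3 0 + momentArray A 2 1) + (12 : ℂ) • momentArray A 2 0 +
      (8 : ℂ) • momentArray A 1 1 + (4 + 2 * k) • momentArray A 1 0 +
      (2 * k) • momentArray A 0 1 + k • momentArray A 0 0 := by
  funext i j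
  simp only [Pi.add_apply, Pi.smul_apply, smul_eq_mul, momentArray]
  ring

theorem curve_array_left' (A : ℕ → ℕ → ℂ) (γ : ℂ) :
    (fun i j => 8 * (j * ((i + j) ^ 2 - γ)) * A i j : ℕ → ℕ → ℂ) =
    (8 : ℂ) • (momentArray A 0 3 + (2 : ℂ) • momentArray A 1 2 + momentArray A 2 1 -
      γ • momentArray A 0 1) := by
  funext i j
  simp only [Pi.add_apply, Pi.sub_apply, Pi.smul_apply, smul_eq_mul, momentArray]
  ring

theorem curve_array_right' (A : ℕ → ℕ → ℂ) (l : ℂ) :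
    (fun i j => (1 + 2 * i + 2 * j) * (4 * j ^ 2 + 4 * j + l) * A i j : ℕ → ℕ → ℂ) =
    (8 : ℂ) • (momentArray A 0 3 + momentArray A 1 2) + (12 : ℂ) • momentArray A 0 2 +
      (8 : ℂ) • momentArray A 1 1 + (4 + 2 * l) • momentArray A 0 1 +
      (2 * l) • momentArray A 1 0 + l • momentArray A 0 0 := by
  funext i j
  simp only [Pi.add_apply, Pi.smul_apply, smul_eq_mul, momentArray]
  ring

theorem curve_array_cross (A : ℕ → ℕ → ℂ) (l : ℂ) :
    (fun i j => i * (4 * j ^ 2 + 4 * j + l) * A i j : ℕ → ℕ → ℂ) =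
    (4 : ℂ) • (momentArray A 1 2 + momentArray A 1 1) + l • momentArray A 1 0 := by
  funext i j
  simp only [Pi.add_apply, Pi.smul_apply, smul_eq_mul, momentArray]
  ring

theorem curve_array_cross' (A : ℕ → ℕ → ℂ) (k : ℂ) :
    (fun i j => j * (4 * i ^ 2 + 4 * i + k) * A i j : ℕ → ℕ → ℂ) =
    (4 : ℂ) • (momentArray A 2 1 + momentArray A 1 1) + k • momentArray A 0 1 := by
  funext i j
  simp only [Pi.add_apply, Pi.smul_apply, smul_eq_mul, momentArray]
  ring

/-- A double series of type `F^{1:2;2}_{2:0;0}` restricted to the curve `(1 - x) y = -x`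
satisfies a third order equation. -/
theorem curve_ode {c k l : ℂ} {A : ℕ → ℕ → ℂ} {y Y : ℂ⟦X⟧} (hy : (1 - X) * y = -X)
    (hc : ∀ n : ℕ, c + n ≠ 0) (hc' : ∀ n : ℕ, 2 - c + n ≠ 0)
    (h1 : ∀ i j, 8 * A (i + 1) j * ((c + (i + j : ℕ)) * (2 - c + (i + j : ℕ)) * (i + 1)) =
      (1 + 2 * i + 2 * j) * (4 * i ^ 2 + 4 * i + k) * A i j)
    (h2 : ∀ i j, 8 * A i (j + 1) * ((c + (i + j : ℕ)) * (2 - c + (i + j : ℕ)) * (j + 1)) =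
      (1 + 2 * i + 2 * j) * (4 * j ^ 2 + 4 * j + l) * A i j)
    (hY : Y = diagSum y A) :
    8 * eulerD (eulerD (eulerD Y)) = -(12 * X) * eulerD (eulerD Y) +
      (2 * C k * X * (1 - X) + 8 * (C c - 1) ^ 2 * (1 - X) - 4 * X - 2 * X * C l) * eulerD Y +
      (C k * X * (1 - X) ^ 2 - X * C l) * Y := by
  have hone : mk 1 * (1 - X : ℂ⟦X⟧) = 1 := mk_one_mul_one_sub_eq_one ℂ
  have hyX : y = -X * mk 1 := by linear_combination mk 1 * hy - y * hone
  have hX : X ∣ y := ⟨-mk 1, by rw [hyX]; ring⟩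
  have hX1 : eulerD (1 - X : ℂ⟦X⟧) = -(X * (1 - X)) := by rw [map_sub, eulerD_X]; simp
  have hEy : eulerD y = 1 * y := by
    have h := congrArg eulerD hy
    rw [Derivation.leibniz, hX1, map_neg, eulerD_X, smul_eq_mul, smul_eq_mul] at h
    linear_combination mk 1 * h - (eulerD y - X * y + X) * hone - hy
  set Φ := diagSum y with hΦ
  have hE' (s t : ℕ) : eulerD (Φ (momentArray A s t)) = (1 - X) * Φ (momentArray A (s + 1) t) +
      Φ (momentArray A s (t + 1)) := by rw [eulerD_diagSum hX hEy]; ring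
  have h00 : momentArray A 0 0 = A := by funext i j; simp [momentArray]
  have r1 : Φ (fun i j => 8 * (i * ((i + j) ^ 2 - (c - 1) ^ 2)) * A i j) =
      X * Φ (fun i j => (1 + 2 * i + 2 * j) * (4 * i ^ 2 + 4 * i + k) * A i j) := by
    refine diagSum_shift_fst hX (by simp) fun i j => ?_
    have := h1 i j
    push_cast at this ⊢
    linear_combination this
  have r2 : Φ (fun i j => 8 * (j * ((i + j) ^ 2 - (c - 1) ^ 2)) * A i j) =
      y * Φ (fun i j => (1 + 2 * i + 2 * j) * (4 * j ^ 2 + 4 * j + l) * A i j) := by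
    refine diagSum_shift_snd hX (by simp) fun i j => ?_
    have := h2 i j
    push_cast at this ⊢
    linear_combination this
  have hcross (i j : ℕ) : A (i + 1) j * ((i + 1) * (4 * j ^ 2 + 4 * j + l)) =
      A i (j + 1) * ((j + 1) * (4 * i ^ 2 + 4 * i + k)) := by
    apply mul_left_cancel₀ (mul_ne_zero (hc (i + j)) (hc' (i + j)))
    linear_combination (4 * j ^ 2 + 4 * j + l) * h1 i j / 8 - (4 * i ^ 2 + 4 * i + k) * h2 i j / 8
  have r3 : y * Φ (fun i j => i * (4 * j ^ 2 + 4 * j + l) * A i j) =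
      X * Φ (fun i j => j * (4 * i ^ 2 + 4 * i + k) * A i j) := by
    set D : ℕ → ℕ → ℂ := fun i j => A i (j + 1) * ((j + 1) * (4 * i ^ 2 + 4 * i + k)) with hD
    have e1 : Φ (fun i j => i * (4 * j ^ 2 + 4 * j + l) * A i j) = X * Φ D := by
      refine diagSum_shift_fst hX (by simp) fun i j => ?_
      rw [hD]
      push_cast
      linear_combination hcross i j
    have e2 : Φ (fun i j => j * (4 * i ^ 2 + 4 * i + k) * A i j) = y * Φ D := by
      refine diagSum_shift_snd hX (by simp) fun i j => ?_
      rw [hD]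
      push_cast
      ring
    rw [e1, e2]
    ring
  have hC2 : (C (2 : ℂ) : ℂ⟦X⟧) = 2 := map_ofNat C 2
  have hC4 : (C (4 : ℂ) : ℂ⟦X⟧) = 4 := map_ofNat C 4
  have hC8 : (C (8 : ℂ) : ℂ⟦X⟧) = 8 := map_ofNat C 8
  have hC12 : (C (12 : ℂ) : ℂ⟦X⟧) = 12 := map_ofNat C 12
  rw [curve_array_left, curve_array_right] at r1
  rw [curve_array_left', curve_array_right'] at r2
  rw [curve_array_cross, curve_array_cross'] at r3
  simp only [map_add, map_smul, smul_eq_C_mul, map_mul, map_sub, map_pow, hC2, hC4, hC8, hC12,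
    map_one] at r1 r2 r3
  have key := restrict_curve_ode eulerD hy eulerD_X (hE' 0 0) (hE' 1 0) (hE' 0 1)
    (hE' 2 0) (hE' 1 1) (hE' 0 2) (c := C c) (k := C k) (l := C l)
    (g30 := Φ (momentArray A 3 0)) (g21 := Φ (momentArray A 2 1))
    (g12 := Φ (momentArray A 1 2)) (g03 := Φ (momentArray A 0 3))
    (g20 := Φ (momentArray A 2 0)) (g11 := Φ (momentArray A 1 1))
    (g02 := Φ (momentArray A 0 2)) (g10 := Φ (momentArray A 1 0))
    (g01 := Φ (momentArray A 0 1)) (g00 := Φ (momentArray A 0 0))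
    (by linear_combination r1) (by linear_combination r2) (by linear_combination r3)
  rwa [h00, ← hY] at key

/-- This series is (1-X)^(-s), since the parameters 1 and 1 cancel. -/
theorem eulerD_binomial (s : ℂ) :
    eulerD (hypSeries s 1 1) = C s * X * hypSeries s 1 1 := by
  have hone (k : ℕ) : (1 : ℂ) + k ≠ 0 := by
    rw [add_comm]; exact_mod_cast k.succ_ne_zero
  set F := fun k => coeff k (hypSeries s 1 1) with hF
  have hFm : hypSeries s 1 1 = mk F := by ext; simp [hF]
  have hrec : mk (fun n => (n : ℂ) * F n) = X * (mk (fun n => (n : ℂ) * F n) + C s * mk F) := by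
    ext n
    cases n with
    | zero => simp
    | succ n =>
      have h := coeff_hypSeries_succ (a := s) (b := 1) hone n
      rw [coeff_succ_X_mul]
      simp only [map_add, coeff_mk, coeff_C_mul]
      apply mul_left_cancel₀ (hone n)
      push_cast
      linear_combination h
  rw [hFm, eulerD_mk]
  linear_combination hrec

theorem coeff122_succ_fst {a p₁ p₂ q₁ q₂ b c : ℂ} (hb : ∀ n : ℕ, b + n ≠ 0)
    (hc : ∀ n : ℕ, c + n ≠ 0) (i j : ℕ) :
    coeff122 a p₁ p₂ q₁ q₂ b c (i + 1) j * ((b + (i + j : ℕ)) * (c + (i + j : ℕ)) * (i + 1)) =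
      (a + (i + j : ℕ)) * (p₁ + i) * (q₁ + i) * coeff122 a p₁ p₂ q₁ q₂ b c i j := by
  have h1 : poch b (i + j) ≠ 0 := poch_ne_zero fun i _ => hb i
  have h2 : poch c (i + j) ≠ 0 := poch_ne_zero fun i _ => hc i
  have h3 : (i.factorial : ℂ) ≠ 0 := by exact_mod_cast i.factorial_ne_zero
  have h4 : (j.factorial : ℂ) ≠ 0 := by exact_mod_cast j.factorial_ne_zero
  have h5 : (i + 1 : ℂ) ≠ 0 := by exact_mod_cast i.succ_ne_zero
  have h6 := hb (i + j)
  have h7 := hc (i + j)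
  rw [coeff122, coeff122, show i + 1 + j = i + j + 1 by ring]
  simp only [poch_succ, Nat.factorial_succ, Nat.cast_mul, Nat.cast_succ]
  field_simp

theorem coeff122_succ_snd {a p₁ p₂ q₁ q₂ b c : ℂ} (hb : ∀ n : ℕ, b + n ≠ 0)
    (hc : ∀ n : ℕ, c + n ≠ 0) (i j : ℕ) :
    coeff122 a p₁ p₂ q₁ q₂ b c i (j + 1) * ((b + (i + j : ℕ)) * (c + (i + j : ℕ)) * (j + 1)) =
      (a + (i + j : ℕ)) * (p₂ + j) * (q₂ + j) * coeff122 a p₁ p₂ q₁ q₂ b c i j := by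
  have h (i j : ℕ) : coeff122 a p₁ p₂ q₁ q₂ b c i j = coeff122 a p₂ p₁ q₂ q₁ b c j i := by
    rw [coeff122, coeff122, add_comm i j]; ring
  rw [h i (j + 1), h i j, add_comm i j]
  exact coeff122_succ_fst hb hc j i

/-- The formal identity behind the generalization of Chaundy's identity. -/
theorem chaundy_formal {a b c : ℂ} (hc : ∀ k : ℕ, c ≠ -(k : ℂ)) (hc' : ∀ k : ℕ, 2 - c ≠ -(k : ℂ)) :
    hypSeries (c - a - b - 1 / 2) 1 1 *
        (hypSeries a b c * hypSeries (1 + a - c) (1 + b - c) (2 - c)) =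
      diagSum (-X * mk 1) (coeff122 (1 / 2) (a - b + 1 / 2) (a + b - c + 1 / 2)
        (b - a + 1 / 2) (c - a - b + 1 / 2) c (2 - c)) := by
  have hcn := add_ne_zero_of_ne_neg hc
  have hcn' := add_ne_zero_of_ne_neg hc'
  set A := coeff122 (1 / 2) (a - b + 1 / 2) (a + b - c + 1 / 2)
        (b - a + 1 / 2) (c - a - b + 1 / 2) c (2 - c) with hA
  have hone : mk 1 * (1 - X : ℂ⟦X⟧) = 1 := mk_one_mul_one_sub_eq_one ℂ
  have hC2 : (C (2 : ℂ) : ℂ⟦X⟧) = 2 := map_ofNat C 2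
  have hC4 : (C (4 : ℂ) : ℂ⟦X⟧) = 4 := map_ofNat C 4
  have hy : (1 - X) * (-X * mk 1) = (-X : ℂ⟦X⟧) := by linear_combination -X * hone
  -- Here k comes from (a-b+1/2+i)(b-a+1/2+i) = (4i²+4i+k)/4, and l likewise from the pair of
  -- parameters indexed by j.
  have hG := curve_ode (A := A) (k := 1 - 4 * (a - b) ^ 2) (l := 1 - 4 * (a + b - c) ^ 2) hy hcn
    hcn' (fun i j => by
      have h := coeff122_succ_fst (a := 1 / 2) (p₁ := a - b + 1 / 2) (p₂ := a + b - c + 1 / 2)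
        (q₁ := b - a + 1 / 2) (q₂ := c - a - b + 1 / 2) hcn hcn' i j
      rw [← hA] at h
      push_cast at h ⊢
      linear_combination 8 * h)
    (fun i j => by
      have h := coeff122_succ_snd (a := 1 / 2) (p₁ := a - b + 1 / 2) (p₂ := a + b - c + 1 / 2)
        (q₁ := b - a + 1 / 2) (q₂ := c - a - b + 1 / 2) hcn hcn' i j
      rw [← hA] at h
      push_cast at h ⊢
      linear_combination 8 * h) rfl
  have hP := product_ode eulerD eulerD_X (eulerD_C a) (eulerD_C b) (eulerD_C c)
    (w := hypSeries (c - a - b - 1 / 2) 1 1)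
    (by
      rw [eulerD_binomial]
      have hh : (C (1 / 2 : ℂ) : ℂ⟦X⟧) * 2 = 1 := by
        rw [← hC2, ← map_mul]; norm_num
      simp only [map_sub]
      linear_combination -X * hypSeries (c - a - b - 1 / 2) 1 1 * hh)
    (hypSeries_ode hcn (a := a) (b := b))
    (by
      have h := hypSeries_ode hcn' (a := 1 + a - c) (b := 1 + b - c)
      simp only [map_sub, map_add, map_one, hC2] at h
      linear_combination h)
  simp only [map_sub, map_mul, map_pow, map_add, map_one, hC4] at hG
  rw [← sub_eq_zero]
  set P := hypSeries (c - a - b - 1 / 2) 1 1 *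
        (hypSeries a b c * hypSeries (1 + a - c) (1 + b - c) (2 - c)) with hPdef
  set G := diagSum (-X * mk 1) A with hGdef
  have h8 : (C (1 / 8 : ℂ) : ℂ⟦X⟧) * 8 = 1 := by
    rw [← map_ofNat C 8, ← map_mul]; norm_num
  have hD : eulerD (eulerD (eulerD (P - G))) =
      C (1 / 8) * (-(12 * X)) * eulerD (eulerD (P - G)) +
      C (1 / 8) * (2 * (1 - 4 * (C a - C b) ^ 2) * X * (1 - X) + 8 * (C c - 1) ^ 2 * (1 - X) -
        4 * X - 2 * X * (1 - 4 * (C a + C b - C c) ^ 2)) * eulerD (P - G) +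
      C (1 / 8) * ((1 - 4 * (C a - C b) ^ 2) * X * (1 - X) ^ 2 -
        X * (1 - 4 * (C a + C b - C c) ^ 2)) * (P - G) := by
    simp only [map_sub]
    linear_combination C (1 / 8) * hP - C (1 / 8) * hG -
      (eulerD (eulerD (eulerD P)) - eulerD (eulerD (eulerD G))) * h8
  refine eq_zero_of_third_order hD fun n hn => ?_
  have hcc8 : constantCoeff (8 : ℂ⟦X⟧) = 8 := map_ofNat _ 8
  simp only [coeff_zero_eq_constantCoeff, map_mul, map_sub, map_add, map_pow, map_neg,
    constantCoeff_X, constantCoeff_C, map_one, hcc8] at hn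
  -- The exponents are 0, 1-c and c-1; the assumptions on c exclude every positive integer.
  have hn0 : (n : ℂ) * ((c + (n - 1)) * (2 - c + (n - 1))) = 0 := by linear_combination hn
  have : n = 0 := by
    by_contra hne
    obtain ⟨m, rfl⟩ := Nat.exists_eq_succ_of_ne_zero hne
    refine mul_ne_zero (by exact_mod_cast hne) (mul_ne_zero ?_ ?_) hn0
    · simpa using hcn m
    · simpa using hcn' m
  subst this
  have e1 : coeff 0 P = 1 := by
    rw [hPdef, coeff_zero_eq_constantCoeff, map_mul, map_mul]
    simp only [constantCoeff_hypSeries, mul_one]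
  have e2 : coeff 0 G = 1 := by
    rw [hGdef, coeff_diagSum ⟨-mk 1, by ring⟩ A Nat.zero_lt_one, colSum_apply]
    simp [hA, coeff122]
  rw [map_sub, e1, e2, sub_self]

end DoubleArrays

/-! ### Symmetric square of the Gauss equation, Watson's sum, and the formal Clausen identity. -/

section Clausen

open PowerSeries

/-- The symmetric square equation, as a predicate on formal power series. -/
def IsSymSq (u v Y : ℂ⟦X⟧) : Prop :=
  eulerD (eulerD (eulerD Y)) = 3 * u * eulerD (eulerD Y) +
      (4 * v + eulerD u - 2 * u ^ 2) * eulerD Y + (2 * eulerD v - 4 * u * v) * Y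

/-- The first order coefficient of the Gauss equation with lower parameter `p + 1 / 2`. -/
noncomputable def gaussU (a b p : ℂ) : ℂ⟦X⟧ := -(C (p - 1 / 2) + C (1 - a - b) * X)

/-- The zeroth order coefficient of the Gauss equation. -/
noncomputable def gaussV (a b : ℂ) : ℂ⟦X⟧ := C (a * b) * (X * (1 - X))

theorem IsSymSq.sub {u v Y Z : ℂ⟦X⟧} (hY : IsSymSq u v Y) (hZ : IsSymSq u v Z) :
    IsSymSq u v (Y - Z) := by
  unfold IsSymSq at *
  simp only [map_sub]
  linear_combination hY - hZ

theorem eulerD_C_mul (r : ℂ) (Y : ℂ⟦X⟧) : eulerD (C r * Y) = C r * eulerD Y := by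
  rw [Derivation.leibniz, eulerD_C, smul_zero, add_zero, smul_eq_mul]

theorem IsSymSq.C_mul {u v Y : ℂ⟦X⟧} (r : ℂ) (hY : IsSymSq u v Y) : IsSymSq u v (C r * Y) := by
  unfold IsSymSq at *
  simp only [eulerD_C_mul]
  linear_combination C r * hY

theorem hypSeries_gauss {a b p : ℂ} (hc : ∀ k : ℕ, p + 1 / 2 + k ≠ 0) :
    eulerD (eulerD (hypSeries a b (p + 1 / 2))) =
      gaussU a b p * eulerD (hypSeries a b (p + 1 / 2)) +
        gaussV a b * hypSeries a b (p + 1 / 2) := by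
  rw [hypSeries_ode hc, gaussU, gaussV]
  have : (C (p - 1 / 2) : ℂ⟦X⟧) = C (p + 1 / 2) - 1 := by
    rw [← map_one C, ← map_sub]; congr 1; ring
  rw [this]
  simp only [map_sub, map_mul, map_one]
  ring

/-- The Gauss exponents at 0 are 0 and 1/2-p; their pairwise sums 0, 1/2-p, 1-2p are the exponents
of the symmetric square. -/
theorem IsSymSq.eq_zero {a b p : ℂ} {Y : ℂ⟦X⟧} (h : IsSymSq (gaussU a b p) (gaussV a b) Y)
    (h0 : ∀ n : ℕ, (n : ℂ) * (n + p - 1 / 2) * (n + 2 * p - 1) = 0 → coeff n Y = 0) : Y = 0 := by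
  refine eq_zero_of_third_order h fun n hn => h0 n ?_
  have h3 : constantCoeff (3 : ℂ⟦X⟧) = 3 := map_ofNat _ 3
  have h4 : constantCoeff (4 : ℂ⟦X⟧) = 4 := map_ofNat _ 4
  have h2 : constantCoeff (2 : ℂ⟦X⟧) = 2 := map_ofNat _ 2
  have hE (f : ℂ⟦X⟧) : constantCoeff (eulerD f) = 0 := by rw [eulerD_apply]; simp
  have hu : constantCoeff (gaussU a b p) = -(p - 1 / 2) := by simp [gaussU]
  have hv : constantCoeff (gaussV a b) = 0 := by simp [gaussV]
  simp only [coeff_zero_eq_constantCoeff, map_mul, map_sub, map_add, map_pow, hE, hu, hv,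
    h2, h3, h4] at hn
  linear_combination hn

/-- Arrays of the shape occurring in `F^{2:1;1}_{1:1;1}`. -/
noncomputable def productArray (a b : ℂ) (r s : ℕ → ℂ) (i j : ℕ) : ℂ :=
  poch (2 * a) (i + j) * poch (2 * b) (i + j) / poch (a + b + 1 / 2) (i + j) *
    (r i / i.factorial) * (s j / j.factorial)

theorem productArray_succ_fst {a b p : ℂ} {r s : ℕ → ℂ} (hc : ∀ k : ℕ, a + b + 1 / 2 + k ≠ 0)
    (hr : ∀ i : ℕ, r (i + 1) * (2 * p + i) = r i * (p + i)) (i j : ℕ) :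
    productArray a b r s (i + 1) j * ((a + b + 1 / 2 + (i + j : ℕ)) * (2 * p + i) * (i + 1)) =
      (2 * a + (i + j : ℕ)) * (2 * b + (i + j : ℕ)) * (p + i) * productArray a b r s i j := by
  have h1 : poch (a + b + 1 / 2) (i + j) ≠ 0 := poch_ne_zero fun i _ => hc i
  have h3 : (i.factorial : ℂ) ≠ 0 := by exact_mod_cast i.factorial_ne_zero
  have h5 : (i + 1 : ℂ) ≠ 0 := by exact_mod_cast i.succ_ne_zero
  have h6 := hc (i + j)
  have e : productArray a b r s (i + 1) j *
      ((a + b + 1 / 2 + (i + j : ℕ)) * (2 * p + i) * (i + 1)) =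
      (2 * a + (i + j : ℕ)) * (2 * b + (i + j : ℕ)) *
        (poch (2 * a) (i + j) * poch (2 * b) (i + j) / poch (a + b + 1 / 2) (i + j) *
        ((r (i + 1) * (2 * p + i)) / i.factorial) * (s j / j.factorial)) := by
    rw [productArray, show i + 1 + j = i + j + 1 by ring]
    simp only [poch_succ, Nat.factorial_succ, Nat.cast_mul, Nat.cast_succ]
    generalize poch (a + b + 1 / 2) (i + j) = P at *
    generalize a + b + 1 / 2 + ((i + j : ℕ) : ℂ) = d at *
    field_simp
  rw [e, hr, productArray]
  ring

theorem productArray_swap (a b : ℂ) (r s : ℕ → ℂ) (i j : ℕ) :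
    productArray a b r s i j = productArray a b s r j i := by
  rw [productArray, productArray, add_comm i j]
  ring

theorem productArray_succ_snd {a b q : ℂ} {r s : ℕ → ℂ} (hc : ∀ k : ℕ, a + b + 1 / 2 + k ≠ 0)
    (hs : ∀ j : ℕ, s (j + 1) * (2 * q + j) = s j * (q + j)) (i j : ℕ) :
    productArray a b r s i (j + 1) * ((a + b + 1 / 2 + (i + j : ℕ)) * (2 * q + j) * (j + 1)) =
      (2 * a + (i + j : ℕ)) * (2 * b + (i + j : ℕ)) * (q + j) * productArray a b r s i j := by
  rw [productArray_swap a b r s i (j + 1), productArray_swap a b r s i j, add_comm i j]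
  exact productArray_succ_fst hc hs j i

/-- The ratio `(-n)_j / (-2n)_j`, cut off after `j = n`. -/
noncomputable def termRatio (n j : ℕ) : ℂ :=
  if j ≤ n then poch (-n) j / poch (-(2 * n)) j else 0

theorem poch_neg_two_mul_ne_zero {n j : ℕ} (h : j ≤ n) : poch (-(2 * n : ℂ)) j ≠ 0 :=
  poch_ne_zero fun i hi h0 => by
    have : (i : ℂ) = (2 * n : ℕ) := by push_cast; linear_combination h0
    have : i = 2 * n := by exact_mod_cast this
    omega

theorem termRatio_of_lt {n j : ℕ} (h : n < j) : termRatio n j = 0 := if_neg (by omega)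

@[simp] theorem termRatio_zero (n : ℕ) : termRatio n 0 = 1 := by simp [termRatio]

/-- The recurrence survives the cut-off: at j = n the right factor vanishes, and afterwards both
terms are zero, so the zero of the left factor at j = 2n does no harm. -/
theorem termRatio_succ (n j : ℕ) :
    termRatio n (j + 1) * (2 * (-n : ℂ) + j) = termRatio n j * (-n + j) := by
  rcases lt_trichotomy j n with h | h | h
  · have h1 := poch_neg_two_mul_ne_zero (n := n) (j := j + 1) h
    rw [poch_succ] at h1
    have h2 := left_ne_zero_of_mul h1
    have h3 := right_ne_zero_of_mul h1
    rw [termRatio, termRatio, if_pos (by omega), if_pos (by omega), poch_succ, poch_succ,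
      show 2 * (-n : ℂ) + j = -(2 * n) + j by ring]
    generalize poch (-(2 * n : ℂ)) j = P at *
    generalize -(2 * n : ℂ) + j = d at *
    field_simp
  · subst h
    simp [termRatio_of_lt]
  · rw [termRatio_of_lt h, termRatio_of_lt (by omega)]
    ring

theorem termRatio_succ_fst {n j : ℕ} (h : j ≤ n) :
    termRatio (n + 1) j * (2 * (n + 1 - j) * (2 * n + 1)) =
      (2 * n + 1 - j) * (2 * n + 2 - j) * termRatio n j := by
  induction j with
  | zero => simp; ring
  | succ j ih =>
    have h1 := termRatio_succ (n + 1) j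
    have h2 := termRatio_succ n j
    have h3 : (2 * (-(n + 1 : ℕ)) + j : ℂ) ≠ 0 := fun h0 => by
      have : (j : ℂ) = (2 * (n + 1) : ℕ) := by push_cast at h0 ⊢; linear_combination h0
      have : j = 2 * (n + 1) := by exact_mod_cast this
      omega
    have h4 : (2 * (-n : ℂ) + j) ≠ 0 := fun h0 => by
      have : (j : ℂ) = (2 * n : ℕ) := by push_cast; linear_combination h0
      have : j = 2 * n := by exact_mod_cast this
      omega
    apply mul_left_cancel₀ (mul_ne_zero h3 h4)
    have ih := ih (by omega)
    push_cast at h1 h3 ih ⊢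
    linear_combination (2 * (-n : ℂ) + j) * (2 * (n - j) * (2 * n + 1)) * h1 -
      (2 * (-(n + 1)) + j) * (2 * n - j) * (2 * n + 1 - j) * h2 +
      (n - j) * (2 * n - j) * ih

/-- The terms of the terminating Watson sum. -/
noncomputable def watsonTerm (a b : ℂ) (n j : ℕ) : ℂ :=
  productArray a b (fun _ => 1) (termRatio n) 0 j

theorem watsonTerm_succ {a b : ℂ} (hc : ∀ k : ℕ, a + b + 1 / 2 + k ≠ 0) (n j : ℕ) :
    watsonTerm a b n (j + 1) * ((a + b + 1 / 2 + j) * (2 * (-n : ℂ) + j) * (j + 1)) =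
      (2 * a + j) * (2 * b + j) * (-n + j) * watsonTerm a b n j := by
  have := productArray_succ_snd (r := fun _ => 1) hc (termRatio_succ n) 0 j
  rwa [zero_add] at this

theorem watsonTerm_succ_fst (a b : ℂ) {n j : ℕ} (h : j ≤ n) :
    watsonTerm a b (n + 1) j * (2 * (n + 1 - j) * (2 * n + 1)) =
      (2 * n + 1 - j) * (2 * n + 2 - j) * watsonTerm a b n j := by
  simp only [watsonTerm, productArray]
  linear_combination (poch (2 * a) (0 + j) * poch (2 * b) (0 + j) /
    poch (a + b + 1 / 2) (0 + j) / j.factorial) * termRatio_succ_fst h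

theorem watsonTerm_of_lt (a b : ℂ) {n j : ℕ} (h : n < j) : watsonTerm a b n j = 0 := by
  simp [watsonTerm, productArray, termRatio_of_lt h]

@[simp] theorem watsonTerm_zero (a b : ℂ) (n : ℕ) : watsonTerm a b n 0 = 1 := by
  simp [watsonTerm, productArray]

/-- Telescoping certificate for the terminating Watson sum. -/
theorem watson_telescope {a b : ℂ} (hc : ∀ k : ℕ, a + b + 1 / 2 + k ≠ 0) (n N : ℕ)
    (hN : N ≤ n + 1) :
    ∑ j ∈ Finset.range (N + 1), ((1 / 2 + n) * (a + b + 1 / 2 + n) * watsonTerm a b (n + 1) j -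
      (a + 1 / 2 + n) * (b + 1 / 2 + n) * watsonTerm a b n j) =
      -((2 * a + N) * (2 * b + N) * watsonTerm a b n N) / 4 := by
  induction N with
  | zero => simp; ring
  | succ j ih =>
    rw [Finset.sum_range_succ, ih (by omega)]
    have hj : j ≤ n := by omega
    have hcj := hc j
    have hj1 : (j + 1 : ℂ) ≠ 0 := by exact_mod_cast j.succ_ne_zero
    have h1 := watsonTerm_succ hc n j
    have h2 := watsonTerm_succ hc (n + 1) j
    have h3 := watsonTerm_succ_fst a b hj
    have h5 : (2 * (-(n + 1 : ℕ)) + j : ℂ) ≠ 0 := fun h0 => by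
      have : (j : ℂ) = (2 * (n + 1) : ℕ) := by push_cast at h0 ⊢; linear_combination h0
      have : j = 2 * (n + 1) := by exact_mod_cast this
      omega
    have h6 : (2 * n + 1 : ℂ) ≠ 0 := by exact_mod_cast (2 * n).succ_ne_zero
    -- Eliminating the term (n+1, j) expresses (n+1, j+1) through (n, j), after which every term of
    -- the certificate is a multiple of one value.
    have h7 : watsonTerm a b (n + 1) (j + 1) * ((a + b + 1 / 2 + j) * (j + 1) * (2 * (2 * n + 1))) =
        (2 * a + j) * (2 * b + j) * (2 * n + 1 - j) * watsonTerm a b n j := by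
      apply mul_left_cancel₀ h5
      push_cast at h2 ⊢
      linear_combination (2 * (2 * n + 1)) * h2 - (2 * a + j) * (2 * b + j) * h3
    apply mul_left_cancel₀ (mul_ne_zero hcj hj1)
    -- For j ≤ n the factor -2n+j vanishes only if n = j = 0; then the vanishing of the next term
    -- comes from the cut-off, not from the recurrence.
    by_cases hn : n = 0
    · subst hn
      obtain rfl : j = 0 := by omega
      have h8 : watsonTerm a b 0 (0 + 1) = 0 := watsonTerm_of_lt a b (by omega)
      rw [h8]
      push_cast at h7 ⊢
      linear_combination (a + b + 1 / 2) / 4 * h7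
    · have h9 : (2 * (-n : ℂ) + j) ≠ 0 := fun h0 => by
        have : (j : ℂ) = (2 * n : ℕ) := by push_cast; linear_combination h0
        have : j = 2 * n := by exact_mod_cast this
        omega
      apply mul_left_cancel₀ h9
      push_cast
      linear_combination (2 * (-n : ℂ) + j) * (a + b + 1 / 2 + n) / 4 * h7 +
        (-(a + 1 / 2 + n) * (b + 1 / 2 + n) + (2 * a + j + 1) * (2 * b + j + 1) / 4) * h1

/-- The terminating form of Watson's summation theorem. -/
theorem watson_sum {a b : ℂ} (hc : ∀ k : ℕ, a + b + 1 / 2 + k ≠ 0) (n : ℕ) :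
    poch (1 / 2) n * poch (a + b + 1 / 2) n * ∑ j ∈ Finset.range (n + 1), watsonTerm a b n j =
      poch (a + 1 / 2) n * poch (b + 1 / 2) n := by
  induction n with
  | zero => simp
  | succ n ih =>
    have h := watson_telescope hc n (n + 1) le_rfl
    rw [watsonTerm_of_lt a b (Nat.lt_succ_self n), Finset.sum_sub_distrib, ← Finset.mul_sum,
      ← Finset.mul_sum, Finset.sum_range_succ (fun j => watsonTerm a b n j) (n + 1),
      watsonTerm_of_lt a b (Nat.lt_succ_self n)] at h
    simp only [poch_succ]
    linear_combination poch (1 / 2) n * poch (a + b + 1 / 2) n * h +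
      (a + 1 / 2 + n) * (b + 1 / 2 + n) * ih

/-- At X = 0 the line gives y = 1 and only the row i = 0 survives. -/
theorem coeff_zero_colSum_productArray {a b : ℂ} {n : ℕ} {r : ℕ → ℂ} (hr : r 0 = 1) :
    coeff 0 (colSum (1 - X) (n + 2) (productArray a b r (termRatio n))) =
      ∑ j ∈ Finset.range (n + 1), watsonTerm a b n j := by
  rw [colSum_apply, Finset.sum_range_succ, map_add, map_sum]
  have h0 (j : ℕ) : coeff 0 ((1 - X) ^ j * mk fun i => productArray a b r (termRatio n) i j) =
      watsonTerm a b n j := by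
    rw [coeff_zero_eq_constantCoeff, map_mul, map_pow, map_sub, constantCoeff_X, map_one]
    simp [watsonTerm, productArray, hr]
  simp only [h0]
  rw [watsonTerm_of_lt a b (Nat.lt_succ_self n), add_zero]

theorem productArray_isSymSq {a b p : ℂ} {n : ℕ} {r : ℕ → ℂ}
    (hc : ∀ k : ℕ, a + b + 1 / 2 + k ≠ 0) (hp : p = a + b + n)
    (hr : ∀ i : ℕ, r (i + 1) * (2 * p + i) = r i * (p + i)) :
    IsSymSq (gaussU a b p) (gaussV a b)
      (colSum (1 - X) (n + 2) (productArray a b r (termRatio n))) := by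
  refine line_symSq (q := -n) (by rw [hp]; ring) hc
    (fun i j h => by simp [productArray, termRatio_of_lt h])
    (productArray_succ_fst hc hr) (productArray_succ_snd hc (termRatio_succ n)) rfl rfl rfl

/-- The regularization of the ratio `(w)_i / (2w)_i`. -/
noncomputable def dupRatio (w : ℂ) (i : ℕ) : ℂ :=
  poch (w + ((i + 1) / 2 : ℕ)) (i / 2) / (2 ^ i * poch (w + 1 / 2) (i / 2))

theorem poch_succ_left (a : ℂ) (k : ℕ) : poch a (k + 1) = a * poch (a + 1) k := by
  simp [poch, ascPochhammer_succ_left, Polynomial.eval_comp]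

/-- By duplication (2w)_i = 2^i (w)_⌈i/2⌉ (w+1/2)_⌊i/2⌋, and the factor (w)_⌈i/2⌉ cancels against
(w)_i. What remains is regular also at nonpositive integers w. -/
theorem dupRatio_succ {w : ℂ} (hw : ∀ k : ℕ, w + 1 / 2 + k ≠ 0) (i : ℕ) :
    dupRatio w (i + 1) * (2 * w + i) = dupRatio w i * (w + i) := by
  have hp (k : ℕ) : poch (w + 1 / 2) k ≠ 0 := poch_ne_zero fun i _ => hw i
  obtain ⟨l, rfl | rfl⟩ := Nat.even_or_odd' i
  · have h1 := poch_succ_left (w + l) l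
    rw [poch_succ] at h1
    have hl := hp l
    rw [dupRatio, dupRatio, show (2 * l + 1 + 1) / 2 = l + 1 by omega,
      show (2 * l + 1) / 2 = l by omega, show 2 * l / 2 = l by omega]
    push_cast
    rw [← add_assoc]
    generalize poch (w + 1 / 2) l = P at *
    field_simp
    linear_combination (-2) * 2 ^ (2 * l) * h1
  · have hl := hp l
    have hl' := hw l
    rw [dupRatio, dupRatio, show (2 * l + 1 + 1 + 1) / 2 = l + 1 by omega,
      show (2 * l + 1 + 1) / 2 = l + 1 by omega, show (2 * l + 1) / 2 = l by omega,
      poch_succ, poch_succ, show 2 * w + (2 * l + 1 : ℕ) = 2 * (w + 1 / 2 + l) by push_cast; ring]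
    generalize poch (w + 1 / 2) l = P at *
    generalize w + 1 / 2 + l = d at *
    push_cast
    field_simp
    ring

theorem dupRatio_eq {w : ℂ} (hw : ∀ k : ℕ, w + 1 / 2 + k ≠ 0) {i : ℕ}
    (h : poch (2 * w) i ≠ 0) : dupRatio w i = poch w i / poch (2 * w) i := by
  induction i with
  | zero => simp [dupRatio]
  | succ i ih =>
    rw [poch_succ] at h
    have h1 := left_ne_zero_of_mul h
    have h2 := right_ne_zero_of_mul h
    apply mul_right_cancel₀ h2
    rw [dupRatio_succ hw, ih h1, poch_succ, poch_succ]
    field_simp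

/-- The (regularized) coefficients of the generalized Clausen identity. -/
noncomputable def clausenArray (a b : ℂ) (n : ℕ) : ℕ → ℕ → ℂ :=
  productArray a b (dupRatio (a + b + n)) (termRatio n)

theorem clausen_formal_of_ne {a b : ℂ} {n : ℕ} (hc : ∀ k : ℕ, a + b + 1 / 2 + k ≠ 0)
    (hp : ∀ k : ℕ, a + b + n + k ≠ 0) :
    C (poch (a + 1 / 2) n * poch (b + 1 / 2) n) *
        (hypSeries a b (a + b + n + 1 / 2) * hypSeries a b (a + b + n + 1 / 2)) =
      C (poch (1 / 2) n * poch (a + b + 1 / 2) n) *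
        colSum (1 - X) (n + 2) (clausenArray a b n) := by
  have hc' (k : ℕ) : a + b + n + 1 / 2 + k ≠ 0 := by
    have := hc (n + k)
    push_cast at this
    rwa [show a + b + n + 1 / 2 + k = a + b + 1 / 2 + (n + k) by ring]
  have h1 : IsSymSq (gaussU a b (a + b + n)) (gaussV a b)
      (hypSeries a b (a + b + n + 1 / 2) * hypSeries a b (a + b + n + 1 / 2)) :=
    symSq_ode eulerD (hypSeries_gauss hc')
  have h2 : IsSymSq (gaussU a b (a + b + n)) (gaussV a b)
      (colSum (1 - X) (n + 2) (clausenArray a b n)) :=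
    productArray_isSymSq hc rfl (dupRatio_succ hc')
  rw [← sub_eq_zero]
  refine ((h1.C_mul _).sub (h2.C_mul _)).eq_zero fun k hk => ?_
  -- For k = l+1 the root 1-2p means 2p = -l: even l contradicts `hp`, odd l contradicts `hc'`.
  have hk0 : k = 0 := by
    by_contra hne
    obtain ⟨l, rfl⟩ := Nat.exists_eq_succ_of_ne_zero hne
    have hl : ((l.succ : ℕ) : ℂ) ≠ 0 := by exact_mod_cast hne
    rcases mul_eq_zero.1 hk with hk | hk
    · rcases mul_eq_zero.1 hk with hk | hk
      · exact hl hk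
      · apply hc' l
        push_cast at hk
        linear_combination hk
    · obtain ⟨r, rfl | rfl⟩ := Nat.even_or_odd' l
      · apply hp r
        push_cast at hk
        linear_combination hk / 2
      · apply hc' r
        push_cast at hk
        linear_combination hk / 2
  subst hk0
  rw [map_sub, coeff_C_mul, coeff_C_mul, clausenArray,
    coeff_zero_colSum_productArray (by simp [dupRatio]), watson_sum hc,
    coeff_zero_eq_constantCoeff, map_mul, constantCoeff_hypSeries]
  ring

theorem continuous_poch (k : ℕ) : Continuous fun a => poch a k :=
  (ascPochhammer ℂ k).continuous

theorem continuousAt_coeff_mul {T : Type*} [TopologicalSpace T] {f g : T → ℂ⟦X⟧} {t : T}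
    (hf : ∀ k, ContinuousAt (fun s => coeff k (f s)) t)
    (hg : ∀ k, ContinuousAt (fun s => coeff k (g s)) t) (k : ℕ) :
    ContinuousAt (fun s => coeff k (f s * g s)) t := by
  simp only [coeff_mul]
  exact tendsto_finsetSum _ fun p _ => (hf p.1).mul (hg p.2)

theorem continuousAt_coeff_C_mul {T : Type*} [TopologicalSpace T] {r : T → ℂ} {f : T → ℂ⟦X⟧}
    {t : T} (hr : ContinuousAt r t) {k : ℕ} (hf : ContinuousAt (fun s => coeff k (f s)) t) :
    ContinuousAt (fun s => coeff k (C (r s) * f s)) t := by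
  simp only [coeff_C_mul]
  exact hr.mul hf

theorem continuousAt_coeff_colSum {T : Type*} [TopologicalSpace T] {A : T → ℕ → ℕ → ℂ} {t : T}
    (hA : ∀ i j, ContinuousAt (fun s => A s i j) t) (y : ℂ⟦X⟧) (N k : ℕ) :
    ContinuousAt (fun s => coeff k (colSum y N (A s))) t := by
  simp only [colSum_apply, map_sum]
  refine tendsto_finsetSum _ fun j _ => ?_
  exact continuousAt_coeff_mul (f := fun _ => y ^ j) (g := fun s => mk fun i => A s i j)
    (fun k => continuousAt_const) (fun k => by simpa using hA k j) k

theorem continuousAt_coeff_hypSeries {T : Type*} [TopologicalSpace T] {a b c : T → ℂ} {t : T}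
    (ha : ContinuousAt a t) (hb : ContinuousAt b t) (hc : ContinuousAt c t)
    (hne : ∀ k : ℕ, c t + k ≠ 0) (k : ℕ) :
    ContinuousAt (fun s => coeff k (hypSeries (a s) (b s) (c s))) t := by
  simp only [hypSeries, coeff_mk]
  refine (((continuous_poch k).continuousAt.comp ha).mul
    ((continuous_poch k).continuousAt.comp hb)).div
    (((continuous_poch k).continuousAt.comp hc).mul continuousAt_const)
    (mul_ne_zero (poch_ne_zero fun i _ => hne i) (by exact_mod_cast k.factorial_ne_zero))

theorem continuousAt_clausenArray {a b : ℂ} {n : ℕ} (hc : ∀ k : ℕ, a + b + 1 / 2 + k ≠ 0)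
    (i j : ℕ) : ContinuousAt (fun b' => clausenArray a b' n i j) b := by
  have hc' (k : ℕ) : a + b + n + 1 / 2 + k ≠ 0 := by
    have := hc (n + k)
    push_cast at this
    rwa [show a + b + n + 1 / 2 + k = a + b + 1 / 2 + (n + k) by ring]
  have hpc {f : ℂ → ℂ} (hf : Continuous f) (k : ℕ) : ContinuousAt (fun b' => poch (f b') k) b :=
    ((continuous_poch k).comp hf).continuousAt
  simp only [clausenArray, productArray, dupRatio]
  refine (((((hpc (f := fun _ => 2 * a) (by fun_prop) _).mul
    (hpc (f := fun b' => 2 * b') (by fun_prop) _)).div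
    (hpc (f := fun b' => a + b' + 1 / 2) (by fun_prop) _) (poch_ne_zero fun i _ => hc i)).mul
    (((hpc (f := fun b' => a + b' + n + ((i + 1) / 2 : ℕ)) (by fun_prop) _).div
      (continuousAt_const.mul (hpc (f := fun b' => a + b' + n + 1 / 2) (by fun_prop) _))
      (mul_ne_zero (pow_ne_zero _ two_ne_zero) (poch_ne_zero fun i _ => hc' i))).div continuousAt_const
      (by exact_mod_cast i.factorial_ne_zero))).mul continuousAt_const)

/-- An imaginary shift moves a real quantity off the real axis, hence away from all excluded
integers and half-integers at once. -/
theorem eq_of_eq_on_imaginary_shift {f g : ℂ → ℂ} {b : ℂ} (hf : ContinuousAt f b)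
    (hg : ContinuousAt g b)
    (h : ∀ ε : ℝ, ε ≠ 0 → f (b + ε * Complex.I) = g (b + ε * Complex.I)) : f b = g b := by
  have hs : Tendsto (fun ε : ℝ => b + ε * Complex.I) (𝓝[≠] 0) (𝓝 b) := by
    have hc : Continuous fun ε : ℝ => b + ε * Complex.I := by fun_prop
    have h0 := hc.tendsto 0
    simp only [Complex.ofReal_zero, zero_mul, add_zero] at h0
    exact h0.mono_left nhdsWithin_le_nhds
  refine tendsto_nhds_unique (hf.tendsto.comp hs) ((hg.tendsto.comp hs).congr' ?_)
  filter_upwards [self_mem_nhdsWithin] with ε hε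
  exact (h ε hε).symm

/-- The formal generalization of Clausen's identity, including the exceptional case. -/
theorem clausen_formal {a b : ℂ} {n : ℕ} (hc : ∀ k : ℕ, a + b + 1 / 2 + k ≠ 0) :
    C (poch (a + 1 / 2) n * poch (b + 1 / 2) n) *
        (hypSeries a b (a + b + n + 1 / 2) * hypSeries a b (a + b + n + 1 / 2)) =
      C (poch (1 / 2) n * poch (a + b + 1 / 2) n) *
        colSum (1 - X) (n + 2) (clausenArray a b n) := by
  by_cases hp : ∀ k : ℕ, a + b + n + k ≠ 0
  · exact clausen_formal_of_ne hc hp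
  push Not at hp
  obtain ⟨m, hm⟩ := hp
  have hc' (k : ℕ) : a + b + n + 1 / 2 + k ≠ 0 := by
    have := hc (n + k)
    push_cast at this
    rwa [show a + b + n + 1 / 2 + k = a + b + 1 / 2 + (n + k) by ring]
  ext k
  have hpc {f : ℂ → ℂ} (hf : Continuous f) : ContinuousAt (fun b' => poch (f b') n) b :=
    ((continuous_poch n).comp hf).continuousAt
  have hF (k : ℕ) :
      ContinuousAt (fun b' => coeff k (hypSeries a b' (a + b' + n + 1 / 2))) b :=
    continuousAt_coeff_hypSeries (a := fun _ => a) (b := fun b' => b')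
      (c := fun b' => a + b' + n + 1 / 2) continuousAt_const continuousAt_id
      (by fun_prop) hc' k
  have hL : ContinuousAt (fun b' => coeff k (C (poch (a + 1 / 2) n * poch (b' + 1 / 2) n) *
      (hypSeries a b' (a + b' + n + 1 / 2) * hypSeries a b' (a + b' + n + 1 / 2)))) b :=
    continuousAt_coeff_C_mul (r := fun b' => poch (a + 1 / 2) n * poch (b' + 1 / 2) n)
      (f := fun b' => hypSeries a b' (a + b' + n + 1 / 2) * hypSeries a b' (a + b' + n + 1 / 2))
      (continuousAt_const.mul (hpc (f := fun b' => b' + 1 / 2) (by fun_prop)))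
      (continuousAt_coeff_mul (f := fun b' => hypSeries a b' (a + b' + n + 1 / 2))
        (g := fun b' => hypSeries a b' (a + b' + n + 1 / 2)) hF hF k)
  have hR : ContinuousAt (fun b' => coeff k (C (poch (1 / 2) n * poch (a + b' + 1 / 2) n) *
        colSum (1 - X) (n + 2) (clausenArray a b' n))) b :=
    continuousAt_coeff_C_mul (r := fun b' => poch (1 / 2) n * poch (a + b' + 1 / 2) n)
      (f := fun b' => colSum (1 - X) (n + 2) (clausenArray a b' n))
      (continuousAt_const.mul (hpc (f := fun b' => a + b' + 1 / 2) (by fun_prop)))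
      (continuousAt_coeff_colSum (A := fun b' => clausenArray a b' n)
        (fun i j => continuousAt_clausenArray hc i j) _ _ k)
  refine eq_of_eq_on_imaginary_shift hL hR fun ε hε => ?_
  have him : (a + b + n).im = 0 := by
    rw [eq_neg_of_add_eq_zero_left hm]; simp
  have hab : a.im + b.im = 0 := by simpa using him
  rw [clausen_formal_of_ne (a := a) (b := b + ε * Complex.I) (n := n)
    (fun k h => by
      have := congrArg Complex.im h
      simp at this
      exact hε (by linarith))
    (fun k h => by
      have := congrArg Complex.im h
      simp at this
      exact hε (by linarith))]

end Clausen

/-! ### The dihedral identity: polynomial double sum and quadratic first integral. -/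

section Dihedral

open PowerSeries

/-- The array of the dihedral identity. -/
noncomputable def dihedralArray (a : ℂ) (m n : ℕ) : ℕ → ℕ → ℂ :=
  productArray a (-a - m - n) (termRatio m) (termRatio n)

/-- The restriction of the dihedral double sum to `y = 1 - X`. -/
noncomputable def dihedralSum (a : ℂ) (m n : ℕ) : ℂ⟦X⟧ :=
  colSum (1 - X) (n + 2) (dihedralArray a m n)

theorem half_sub_ne_zero (m k : ℕ) : (1 / 2 - m + k : ℂ) ≠ 0 := fun h => by
  have : ((2 * k + 1 : ℕ) : ℂ) = (2 * m : ℕ) := by push_cast; linear_combination 2 * h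
  have : 2 * k + 1 = 2 * m := by exact_mod_cast this
  omega

theorem dihedral_lower_ne_zero (a : ℂ) (m n k : ℕ) : a + (-a - m - n) + 1 / 2 + k ≠ 0 := by
  have := half_sub_ne_zero (m + n) k
  push_cast at this
  rwa [show a + (-a - m - n) + 1 / 2 + k = 1 / 2 - (m + n) + k by ring]

theorem dihedralSum_isSymSq (a : ℂ) (m n : ℕ) :
    IsSymSq (gaussU a (-a - m - n) (-m)) (gaussV a (-a - m - n)) (dihedralSum a m n) :=
  productArray_isSymSq (dihedral_lower_ne_zero a m n) (by ring) (termRatio_succ m)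

/-- The leading coefficient of the dihedral double sum. -/
noncomputable def dihedralLead (a : ℂ) (m n : ℕ) : ℂ := (-1) ^ n * dihedralArray a m n m n

theorem topAt_mk_of_zero {f : ℕ → ℂ} {m : ℕ} (h : ∀ i, m < i → f i = 0) :
    TopAt m (mk f) (f m) := ⟨fun i hi => by simp [h i hi], by simp⟩

theorem dihedralSum_topAt (a : ℂ) (m n : ℕ) :
    TopAt (m + n) (dihedralSum a m n) (dihedralLead a m n) := by
  have hcol (j : ℕ) : TopAt m (mk fun i => dihedralArray a m n i j) (dihedralArray a m n m j) :=
    topAt_mk_of_zero fun i hi => by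
      simp [dihedralArray, productArray, termRatio_of_lt hi]
  have hterm (j : ℕ) : TopAt (m + j) ((1 - X) ^ j * mk fun i => dihedralArray a m n i j)
      ((-1) ^ j * dihedralArray a m n m j) := by
    rw [add_comm m j]
    exact (TopAt.one_sub_X_pow j).mul (hcol j)
  have hsum (N : ℕ) (hN : N ≤ n) : TopAt (m + n)
      (∑ j ∈ Finset.range N, (1 - X) ^ j * mk fun i => dihedralArray a m n i j) 0 := by
    induction N with
    | zero => exact ⟨by simp, by simp⟩
    | succ N ih =>
      rw [Finset.sum_range_succ]
      simpa using (ih (by omega)).add ((hterm N).mono (m := m + n) (by omega))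
  have hz : (mk fun i => dihedralArray a m n i (n + 1)) = 0 := by
    ext i
    simp [dihedralArray, productArray, termRatio_of_lt]
  rw [dihedralSum, colSum_apply, Finset.sum_range_succ, Finset.sum_range_succ, hz, mul_zero,
    add_zero]
  simpa [dihedralLead] using (hsum n le_rfl).add (hterm n)

theorem gaussU_topAt (a b p : ℂ) : TopAt 1 (gaussU a b p) (-(1 - a - b)) := by
  have := (TopAt.const (-1)).mul (TopAt.C_add_C_mul_X (p - 1 / 2) (1 - a - b))
  simpa [gaussU] using this

theorem gaussV_topAt (a b : ℂ) : TopAt 2 (gaussV a b) (-(a * b)) := by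
  have := ((TopAt.X_pow 1).mul TopAt.one_sub_X).const_mul (a * b)
  simpa [gaussV] using this

theorem C_two_four : (C (2 : ℂ) : ℂ⟦X⟧) = 2 ∧ (C (4 : ℂ) : ℂ⟦X⟧) = 4 :=
  ⟨map_ofNat C 2, map_ofNat C 4⟩

theorem symSqForm_topAt {a b p k : ℂ} {d : ℕ} {Y : ℂ⟦X⟧} (hab : a + b = -d)
    (hY : TopAt d Y k) :
    TopAt (2 * d + 2) (symSqForm eulerD (gaussU a b p) (gaussV a b) Y) ((a - b) ^ 2 * k ^ 2) := by
  have hE := hY.eulerD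
  have hEE := hE.eulerD
  have h1 := hE.mul hE
  have h2 := (hY.mul hEE).const_mul 2
  have h3 := ((gaussU_topAt a b p).mul (hY.mul hE)).const_mul 2
  have h4 := ((gaussV_topAt a b).mul (hY.mul hY)).const_mul 4
  rw [C_two_four.1] at h2 h3
  rw [C_two_four.2] at h4
  rw [show d + 1 + (d + 1) = 2 * d + 2 by ring] at h1
  rw [show d + (d + 1 + 1) = 2 * d + 2 by ring] at h2
  rw [show 1 + (d + (d + 1)) = 2 * d + 2 by ring] at h3
  rw [show 2 + (d + d) = 2 * d + 2 by ring] at h4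
  have h := ((h1.sub h2).add h3).add h4
  unfold symSqForm
  convert h using 1
  -- The four contributions add up to d² - 4ab times k², which is (a+b)² - 4ab = (a-b)² times k².
  have hd : (d : ℂ) = -(a + b) := by rw [hab, neg_neg]
  push_cast
  rw [hd]
  ring

theorem gaussU_lowAt (a b p : ℂ) : LowAt 0 (gaussU a b p) (-(p - 1 / 2)) :=
  ⟨by simp, by simp [gaussU]⟩

theorem gaussV_lowAt (a b : ℂ) : LowAt 0 (gaussV a b) 0 := ⟨by simp, by simp [gaussV]⟩

/-- The first integral of a combination of two solutions with exponents `0` and `N`. -/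
theorem symSqForm_lowAt {a b p α γ : ℂ} {N : ℕ} (hN : 0 < N) {F S : ℂ⟦X⟧}
    (hF : symSqForm eulerD (gaussU a b p) (gaussV a b) F = 0) (hF0 : coeff 0 F = 1)
    (hS : LowAt N S 1) :
    coeff N (symSqForm eulerD (gaussU a b p) (gaussV a b) (C α * F + C γ * S)) =
      -2 * α * γ * N * (N + (p - 1 / 2)) := by
  set u := gaussU a b p with hu
  set v := gaussV a b with hv
  have hFl : LowAt 0 F 1 := ⟨by simp, hF0⟩
  have hE : LowAt 0 (eulerD F) 0 := by simpa using hFl.eulerD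
  have hEE : LowAt 0 (eulerD (eulerD F)) 0 := by simpa using hE.eulerD
  have hSS : LowAt N (symSqForm eulerD u v S) 0 := by
    have hSE := hS.eulerD
    have hSEE := hSE.eulerD
    have h1 := (hSE.mul hSE).mono (m := N) (by omega)
    have h2 := ((hS.mul hSEE).const_mul 2).mono (m := N) (by omega)
    have h3 := (((gaussU_lowAt a b p).mul (hS.mul hSE)).const_mul 2).mono (m := N) (by omega)
    have h4 := (((gaussV_lowAt a b).mul (hS.mul hS)).const_mul 4).mono (m := N) (by omega)
    rw [C_two_four.1] at h2 h3
    rw [C_two_four.2] at h4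
    unfold symSqForm
    simpa using ((h1.sub h2).add h3).add h4
  -- B is the polarization of the quadratic form. The value at F is zero and the value at S has
  -- order at least 2N, so only the cross term reaches degree N.
  set B := eulerD F * eulerD S - (F * eulerD (eulerD S) + S * eulerD (eulerD F)) +
    u * (F * eulerD S + S * eulerD F) + 4 * (v * (F * S)) with hB
  have hBl : LowAt N B (-N * (N + (p - 1 / 2))) := by
    have hSE := hS.eulerD
    have hSEE := hSE.eulerD
    have h1 := hE.mul hSE
    have h2 := (hFl.mul hSEE)
    have h2' := hS.mul hEE
    have h3 := (gaussU_lowAt a b p).mul ((hFl.mul hSE).add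
      (by simpa using hS.mul hE : LowAt (0 + N) (S * eulerD F) (1 * 0)))
    have h4 := ((gaussV_lowAt a b).mul (hFl.mul hS)).const_mul 4
    rw [C_two_four.2] at h4
    simp only [zero_add, add_zero] at h1 h2 h2' h3 h4
    convert ((h1.sub (h2.add h2')).add h3).add h4 using 1
    ring
  have hexp : symSqForm eulerD u v (C α * F + C γ * S) =
      C (α ^ 2) * symSqForm eulerD u v F + C (2 * α * γ) * B +
        C (γ ^ 2) * symSqForm eulerD u v S := by
    simp only [symSqForm, map_add, eulerD_C_mul, map_mul, map_pow, C_two_four.1, hB]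
    ring
  rw [hexp, hF, mul_zero, zero_add, map_add, coeff_C_mul, coeff_C_mul, hBl.2, hSS.2]
  ring

/-- A solution of the first order equation of the first integral. -/
theorem eulerD_X_pow_mul (M N : ℕ) :
    eulerD (X ^ M * (1 - X) ^ N : ℂ⟦X⟧) =
      ((M : ℂ⟦X⟧) * (1 - X) - (N : ℂ⟦X⟧) * X) * (X ^ M * (1 - X) ^ N) := by
  have hX1 : eulerD (1 - X : ℂ⟦X⟧) = -(X * (1 - X)) := by rw [map_sub, eulerD_X]; simp
  have h1 : eulerD (X ^ M : ℂ⟦X⟧) = (M : ℂ⟦X⟧) * (1 - X) * X ^ M := by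
    rw [Derivation.leibniz_pow, eulerD_X]
    cases M with
    | zero => simp
    | succ M => simp only [smul_eq_mul, nsmul_eq_mul, Nat.add_sub_cancel]; ring
  have h2 : eulerD ((1 - X) ^ N : ℂ⟦X⟧) = -((N : ℂ⟦X⟧) * X) * (1 - X) ^ N := by
    rw [Derivation.leibniz_pow, hX1]
    cases N with
    | zero => simp
    | succ N => simp only [smul_eq_mul, nsmul_eq_mul, Nat.add_sub_cancel]; ring
  rw [Derivation.leibniz, h1, h2, smul_eq_mul, smul_eq_mul]
  ring

theorem natCast_eq_C (n : ℕ) : (n : ℂ⟦X⟧) = C (n : ℂ) := (map_natCast C n).symm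

/-- The first integral of the dihedral sum is a multiple of `X ^ (2m+1) (1-X) ^ (2n+1)`. -/
theorem symSqForm_dihedral {a : ℂ} {m n : ℕ} {Y : ℂ⟦X⟧}
    (hY : IsSymSq (gaussU a (-a - m - n) (-m)) (gaussV a (-a - m - n)) Y) :
    ∃ τ : ℂ, symSqForm eulerD (gaussU a (-a - m - n) (-m)) (gaussV a (-a - m - n)) Y =
      C τ * (X ^ (2 * m + 1) * (1 - X) ^ (2 * n + 1)) := by
  set T := symSqForm eulerD (gaussU a (-a - m - n) (-m)) (gaussV a (-a - m - n)) Y with hT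
  set K : ℂ⟦X⟧ := X ^ (2 * m + 1) * (1 - X) ^ (2 * n + 1) with hK
  have hu : 2 * gaussU a (-a - m - n) (-m) =
      ((2 * m + 1 : ℕ) : ℂ⟦X⟧) * (1 - X) - ((2 * n + 1 : ℕ) : ℂ⟦X⟧) * X := by
    rw [natCast_eq_C, natCast_eq_C, gaussU, ← C_two_four.1, mul_neg, mul_add, ← mul_assoc,
      ← map_mul, ← map_mul]
    rw [show (2 : ℂ) * (1 - a - (-a - m - n)) = (2 * m + 1 : ℕ) + (2 * n + 1 : ℕ) by
      push_cast; ring, show (2 : ℂ) * (-m - 1 / 2) = -(2 * m + 1 : ℕ) by push_cast; ring,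
      map_add, map_neg]
    ring
  have hT' : eulerD T = (((2 * m + 1 : ℕ) : ℂ⟦X⟧) * (1 - X) - ((2 * n + 1 : ℕ) : ℂ⟦X⟧) * X) * T := by
    rw [← hu]
    exact derivation_symSqForm eulerD hY
  refine ⟨coeff (2 * m + 1) T, sub_eq_zero.1 ?_⟩
  have hK' : eulerD K = _ := eulerD_X_pow_mul (2 * m + 1) (2 * n + 1)
  have hKl : LowAt (2 * m + 1) K 1 := by
    have h0 : LowAt 0 ((1 - X) ^ (2 * n + 1) : ℂ⟦X⟧) 1 :=
      ⟨by simp, by rw [coeff_zero_eq_constantCoeff, map_pow, map_sub]; simp⟩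
    simpa using (LowAt.X_pow (2 * m + 1)).mul h0
  refine eq_zero_of_first_order (r := ((2 * m + 1 : ℕ) : ℂ⟦X⟧) * (1 - X) -
    ((2 * n + 1 : ℕ) : ℂ⟦X⟧) * X) ?_ fun k hk => ?_
  · rw [map_sub, eulerD_C_mul, hT', hK', mul_sub]
    ring
  · rw [natCast_eq_C, natCast_eq_C, coeff_zero_eq_constantCoeff] at hk
    simp only [map_sub, map_mul, constantCoeff_C, map_one, constantCoeff_X, mul_zero, sub_zero,
      mul_one] at hk
    have hk : k = 2 * m + 1 := by exact_mod_cast hk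
    rw [hk, map_sub, coeff_C_mul, hKl.2, mul_one, sub_self]

theorem poch_add (a : ℂ) (m n : ℕ) : poch a (m + n) = poch a m * poch (a + m) n := by
  induction n with
  | zero => simp
  | succ n ih => rw [← add_assoc, poch_succ, poch_succ, ih]; push_cast; ring

theorem poch_neg (a : ℂ) (n : ℕ) : poch (-a) n = (-1) ^ n * poch (a - n + 1) n := by
  induction n with
  | zero => simp
  | succ n ih =>
    rw [poch_succ, ih, poch_succ_left, pow_succ]
    push_cast
    rw [show a - (n + 1) + 1 + 1 = a - n + 1 by ring]
    ring

theorem poch_two_mul (a : ℂ) (k : ℕ) :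
    poch (2 * a) (2 * k) = 4 ^ k * poch a k * poch (a + 1 / 2) k := by
  induction k with
  | zero => simp
  | succ k ih =>
    rw [show 2 * (k + 1) = 2 * k + 1 + 1 by ring, poch_succ, poch_succ, ih, poch_succ, poch_succ]
    push_cast
    ring

theorem poch_two_mul_add_one (a : ℂ) (k : ℕ) :
    poch (2 * a) (2 * k + 1) = 2 * 4 ^ k * poch a (k + 1) * poch (a + 1 / 2) k := by
  rw [poch_succ, poch_two_mul, poch_succ]
  push_cast
  ring

theorem poch_one (k : ℕ) : poch 1 k = k.factorial := by
  induction k with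
  | zero => simp
  | succ k ih => rw [poch_succ, ih, Nat.factorial_succ]; push_cast; ring

theorem poch_half_add_ne_zero (m k : ℕ) : poch (m + 1 / 2 : ℂ) k ≠ 0 :=
  poch_ne_zero fun i _ h => by
    have : ((2 * m + 1 + 2 * i : ℕ) : ℂ) = (0 : ℕ) := by push_cast; linear_combination 2 * h
    have : 2 * m + 1 + 2 * i = 0 := by exact_mod_cast this
    omega

theorem poch_half_ne_zero (k : ℕ) : poch (1 / 2 : ℂ) k ≠ 0 := by
  simpa using poch_half_add_ne_zero 0 k

/-- After the signs cancel, the value is 1/(m+1)_m, and (m+1)_m = (2m)!/m! = 4^m (1/2)_m. -/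
theorem termRatio_self (m : ℕ) :
    termRatio m m / m.factorial = 1 / (4 ^ m * poch (1 / 2) m) := by
  have h1 := poch_add 1 m m
  have h2 := poch_two_mul (1 / 2) m
  have hf : (m.factorial : ℂ) ≠ 0 := by exact_mod_cast m.factorial_ne_zero
  have h3 : poch (1 + m : ℂ) m = 4 ^ m * poch (1 / 2) m := by
    rw [← two_mul, ← mul_one_div_cancel (two_ne_zero (α := ℂ)), h2,
      mul_one_div_cancel (two_ne_zero (α := ℂ)), show (1 / 2 + 1 / 2 : ℂ) = 1 by norm_num] at h1
    apply mul_left_cancel₀ (a := poch 1 m) (by rwa [poch_one])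
    linear_combination -h1
  rw [termRatio, if_pos le_rfl, poch_neg, poch_neg, sub_self, zero_add, poch_one,
    show (2 * m - m + 1 : ℂ) = 1 + m by ring, h3]
  have h4 : (-1 : ℂ) ^ m ≠ 0 := pow_ne_zero _ (by norm_num)
  have h5 := poch_half_ne_zero m
  generalize poch (1 / 2 : ℂ) m = P at *
  field_simp

/-- The factor a-b = 2a+m+n fills the gap between (2a)_(m+n) and (2a+m+n+1)_(m+n). The result
(2a)_(2m+2n+1) is split by duplication, and the square of (a+1/2)_(m+n) is factored in its two ways
to match both coefficients. -/
theorem dihedralLead_sq (a : ℂ) (m n : ℕ) :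
    (a - (-a - m - n)) ^ 2 * dihedralLead a m n ^ 2 =
      (poch (a + 1 / 2) n * poch (a + m + 1 / 2) n) / (poch (1 / 2) n * poch (m + 1 / 2) n) *
        ((poch (a + 1 / 2) m * poch (a + n + 1 / 2) m * poch a (m + n + 1) ^ 2) /
          (poch (1 / 2) m * poch (1 / 2) (m + 1) ^ 2 * poch (1 / 2) n * poch (1 / 2) (m + n))) *
        (2 * m + 1) ^ 2 := by
  have hA : (2 * a + (m + n)) * dihedralArray a m n m n =
      2 * poch a (m + n + 1) * poch (a + 1 / 2) (m + n) /
        (poch (1 / 2) (m + n) * poch (1 / 2) m * poch (1 / 2) n) := by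
    have e1 : poch (2 * (-a - m - n)) (m + n) = (-1) ^ (m + n) * poch (2 * a + (m + n) + 1) (m + n) := by
      rw [show (2 * (-a - m - n)) = -(2 * a + 2 * m + 2 * n) by ring, poch_neg]
      push_cast
      congr 2
      ring
    have e2 : poch (a + (-a - m - n) + 1 / 2) (m + n) = (-1) ^ (m + n) * poch (1 / 2) (m + n) := by
      rw [show (a + (-a - m - n) + 1 / 2) = -(m + n - 1 / 2 : ℂ) by ring, poch_neg]
      push_cast
      congr 2
      ring
    have e3 : poch (2 * a) (2 * (m + n) + 1) =
        poch (2 * a) (m + n) * ((2 * a + (m + n)) * poch (2 * a + (m + n) + 1) (m + n)) := by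
      rw [show 2 * (m + n) + 1 = m + n + (m + n + 1) by ring, poch_add, poch_succ_left]
      push_cast
      rfl
    rw [poch_two_mul_add_one] at e3
    rw [dihedralArray, productArray, e1, e2, termRatio_self, termRatio_self]
    have h0 : (-1 : ℂ) ^ (m + n) ≠ 0 := pow_ne_zero _ (by norm_num)
    have h1 := poch_half_ne_zero m
    have h2 := poch_half_ne_zero n
    have h3 := poch_half_ne_zero (m + n)
    generalize poch (1 / 2 : ℂ) m = P₁ at *
    generalize poch (1 / 2 : ℂ) n = P₂ at *
    generalize poch (1 / 2 : ℂ) (m + n) = P₃ at *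
    generalize (-1 : ℂ) ^ (m + n) = e at *
    generalize poch (2 * a + (m + n) + 1) (m + n) = Q at *
    generalize poch (2 * a) (m + n) = Q' at *
    generalize poch (a + 1 / 2) (m + n) = Q₁ at *
    rw [pow_add] at e3
    field_simp
    linear_combination -e3
  have hsq : (a - (-a - m - n)) ^ 2 * dihedralLead a m n ^ 2 =
      ((2 * a + (m + n)) * dihedralArray a m n m n) ^ 2 := by
    have h1 : ((-1 : ℂ) ^ n) ^ 2 = 1 := by rw [← pow_mul, mul_comm, pow_mul]; simp
    rw [dihedralLead]
    linear_combination (2 * a + (m + n)) ^ 2 * dihedralArray a m n m n ^ 2 * h1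
  have f1 : poch (a + 1 / 2) (m + n) = poch (a + 1 / 2) m * poch (a + m + 1 / 2) n := by
    rw [poch_add, show a + 1 / 2 + (m : ℂ) = a + m + 1 / 2 by ring]
  have f2 : poch (a + 1 / 2) (m + n) = poch (a + 1 / 2) n * poch (a + n + 1 / 2) m := by
    rw [add_comm m n, poch_add, show a + 1 / 2 + (n : ℂ) = a + n + 1 / 2 by ring]
  have f3 : poch (1 / 2) (m + n) = poch (1 / 2) m * poch (m + 1 / 2) n := by
    rw [poch_add, add_comm (1 / 2 : ℂ)]
  have f4 : poch (1 / 2) (m + 1) = poch (1 / 2) m * (m + 1 / 2) := by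
    rw [poch_succ, add_comm (1 / 2 : ℂ)]
  have h1 := poch_half_ne_zero m
  have h2 := poch_half_ne_zero n
  have h5 := poch_half_add_ne_zero m n
  have h6 : (m + 1 / 2 : ℂ) ≠ 0 := by simpa [poch_succ] using poch_half_add_ne_zero m 1
  have f5 : (2 * m + 1 : ℂ) = 2 * (m + 1 / 2) := by ring
  rw [hsq, hA, div_pow, mul_pow, sq (poch (a + 1 / 2) (m + n))]
  nth_rewrite 1 [f1]
  rw [f2, f3, f4, f5]
  generalize poch (1 / 2 : ℂ) m = P₁ at *
  generalize poch (1 / 2 : ℂ) n = P₂ at *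
  generalize poch (m + 1 / 2 : ℂ) n = P₃ at *
  generalize (m + 1 / 2 : ℂ) = e at *
  field_simp

theorem natCast_add_half_ne_zero (m k : ℕ) : (m + 1 / 2 + k : ℂ) ≠ 0 := fun h => by
  have : ((2 * m + 1 + 2 * k : ℕ) : ℂ) = (0 : ℕ) := by push_cast; linear_combination 2 * h
  have : 2 * m + 1 + 2 * k = 0 := by exact_mod_cast this
  omega

/-- The second Gauss solution is x^(m+1/2) times a series. Only its square is a power series, so the
integrating factor enters through w = X^(2m+1) with r = (m+1/2)(1-X). -/
theorem dihedral_second_isSymSq (a : ℂ) (m n : ℕ) :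
    IsSymSq (gaussU a (-a - m - n) (-m)) (gaussV a (-a - m - n))
      (X ^ (2 * m + 1) * (hypSeries (a + m + 1 / 2) (1 / 2 - a - n) ((m + 1 : ℕ) + 1 / 2) *
        hypSeries (a + m + 1 / 2) (1 / 2 - a - n) ((m + 1 : ℕ) + 1 / 2))) := by
  have hH : (C (1 / 2 : ℂ) : ℂ⟦X⟧) * 2 = 1 := by
    rw [← C_two_four.1, ← map_mul]; norm_num
  have hX1 : eulerD (1 - X : ℂ⟦X⟧) = -(X * (1 - X)) := by rw [map_sub, eulerD_X]; simp
  refine symSq_ode_twist eulerD (r := C (m + 1 / 2 : ℂ) * (1 - X))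
    (hypSeries_gauss (natCast_add_half_ne_zero (m + 1))) ?_ ?_ ?_
  · have h := eulerD_X_pow_mul (2 * m + 1) 0
    rw [pow_zero, mul_one] at h
    rw [h, map_add]
    push_cast
    rw [natCast_eq_C]
    linear_combination -(1 - X) * X ^ (2 * m + 1) * hH
  · simp only [gaussU, map_add, map_sub, map_neg, map_one, Nat.cast_add, Nat.cast_one]
    linear_combination hH
  · rw [eulerD_C_mul, hX1]
    simp only [gaussU, gaussV, map_add, map_sub, map_neg, map_mul, map_one]
    ring

theorem dihedral_const {a : ℂ} {m n : ℕ} :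
    coeff 0 (dihedralSum a m n) =
      (poch (a + 1 / 2) n * poch (a + m + 1 / 2) n) / (poch (1 / 2) n * poch (m + 1 / 2) n) := by
  have h := watson_sum (dihedral_lower_ne_zero a m n) n
  rw [dihedralSum, dihedralArray, coeff_zero_colSum_productArray (by simp)]
  have e1 : poch (-a - m - n + 1 / 2) n = (-1) ^ n * poch (a + m + 1 / 2) n := by
    rw [show (-a - m - n + 1 / 2) = -(a + m + n - 1 / 2) by ring, poch_neg]
    congr 2
    ring
  have e2 : poch (a + (-a - m - n) + 1 / 2) n = (-1) ^ n * poch (m + 1 / 2) n := by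
    rw [show (a + (-a - m - n) + 1 / 2) = -(m + n - 1 / 2) by ring, poch_neg]
    congr 2
    ring
  rw [e1, e2] at h
  have h0 : (-1 : ℂ) ^ n ≠ 0 := pow_ne_zero _ (by norm_num)
  rw [eq_div_iff (mul_ne_zero (poch_half_ne_zero n) (poch_half_add_ne_zero m n))]
  apply mul_left_cancel₀ h0
  linear_combination h

/-- The coefficients of the two squares in the dihedral identity. -/
noncomputable def dihedralFst (a : ℂ) (m n : ℕ) : ℂ :=
  (poch (a + 1 / 2) n * poch (a + m + 1 / 2) n) / (poch (1 / 2) n * poch (m + 1 / 2) n)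

noncomputable def dihedralSnd (a : ℂ) (m n : ℕ) : ℂ :=
  (poch (a + 1 / 2) m * poch (a + n + 1 / 2) m * poch a (m + n + 1) ^ 2) /
    (poch (1 / 2) m * poch (1 / 2) (m + 1) ^ 2 * poch (1 / 2) n * poch (1 / 2) (m + n))

theorem dihedral_formal_of_ne {a : ℂ} {m n : ℕ} (ha : dihedralFst a m n ≠ 0) :
    C (dihedralFst a m n) * (hypSeries a (-a - m - n) (-m + 1 / 2) *
        hypSeries a (-a - m - n) (-m + 1 / 2)) +
      C (dihedralSnd a m n) * (X ^ (2 * m + 1) *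
        (hypSeries (a + m + 1 / 2) (1 / 2 - a - n) ((m + 1 : ℕ) + 1 / 2) *
          hypSeries (a + m + 1 / 2) (1 / 2 - a - n) ((m + 1 : ℕ) + 1 / 2))) =
      dihedralSum a m n := by
  have hc (k : ℕ) : (-m + 1 / 2 + k : ℂ) ≠ 0 := by
    have := half_sub_ne_zero m k
    rwa [show (-m + 1 / 2 + k : ℂ) = 1 / 2 - m + k by ring]
  have hG := hypSeries_gauss (a := a) (b := -a - m - n) hc
  set F := hypSeries a (-a - m - n) (-m + 1 / 2) *
        hypSeries a (-a - m - n) (-m + 1 / 2) with hF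
  set S := X ^ (2 * m + 1) *
        (hypSeries (a + m + 1 / 2) (1 / 2 - a - n) ((m + 1 : ℕ) + 1 / 2) *
          hypSeries (a + m + 1 / 2) (1 / 2 - a - n) ((m + 1 : ℕ) + 1 / 2)) with hS
  set Y := dihedralSum a m n with hY
  have hF0 : coeff 0 F = 1 := by
    rw [hF, coeff_zero_eq_constantCoeff, map_mul, constantCoeff_hypSeries, mul_one]
  have hSl : LowAt (2 * m + 1) S 1 := by
    have h0 : LowAt 0 (hypSeries (a + m + 1 / 2) (1 / 2 - a - n) ((m + 1 : ℕ) + 1 / 2)) 1 :=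
      ⟨by simp, coeff_zero_hypSeries _ _ _⟩
    have h1 := (LowAt.X_pow (2 * m + 1)).mul (h0.mul h0)
    rwa [add_zero, add_zero, mul_one, mul_one] at h1
  have hFs : IsSymSq (gaussU a (-a - m - n) (-m)) (gaussV a (-a - m - n)) F :=
    symSq_ode eulerD hG
  have hSs : IsSymSq (gaussU a (-a - m - n) (-m)) (gaussV a (-a - m - n)) S :=
    dihedral_second_isSymSq a m n
  have hYs : IsSymSq (gaussU a (-a - m - n) (-m)) (gaussV a (-a - m - n)) Y :=
    dihedralSum_isSymSq a m n
  have hY0 : coeff 0 Y = dihedralFst a m n := dihedral_const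
  set α := dihedralFst a m n with hα
  set γ := coeff (2 * m + 1) (Y - C α * F) with hγ
  have hdec : Y - C α * F - C γ * S = 0 := by
    refine ((hYs.sub (hFs.C_mul α)).sub (hSs.C_mul γ)).eq_zero fun k hk => ?_
    -- With p = -m the exponents are 0, m+1/2 and 2m+1; the middle one is not an integer.
    have hk' : k = 0 ∨ k = 2 * m + 1 := by
      rcases mul_eq_zero.1 hk with hk | hk
      · rcases mul_eq_zero.1 hk with hk | hk
        · left; exact_mod_cast hk
        · exfalso
          have : ((2 * k : ℕ) : ℂ) = (2 * m + 1 : ℕ) := by push_cast; linear_combination 2 * hk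
          have : 2 * k = 2 * m + 1 := by exact_mod_cast this
          omega
      · right
        have : (k : ℂ) = (2 * m + 1 : ℕ) := by push_cast; linear_combination hk
        exact_mod_cast this
    rcases hk' with rfl | rfl
    · rw [map_sub, map_sub, coeff_C_mul, coeff_C_mul, hY0, hF0, hSl.1 0 (by omega)]
      ring
    · rw [map_sub, coeff_C_mul, hSl.2, ← hγ, mul_one, sub_self]
  have hYe : Y = C α * F + C γ * S := by linear_combination hdec
  obtain ⟨τ, hτ⟩ := symSqForm_dihedral hYs
  have hlow := symSqForm_lowAt (α := α) (γ := γ) (N := 2 * m + 1) (by omega)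
    (symSqForm_sq eulerD hG) hF0 hSl
  have hK0 : LowAt 0 ((1 - X) ^ (2 * n + 1) : ℂ⟦X⟧) 1 :=
    ⟨by simp, by rw [coeff_zero_eq_constantCoeff, map_pow, map_sub]; simp⟩
  have hKl := ((LowAt.X_pow (2 * m + 1)).mul hK0).const_mul τ
  rw [← hYe, hτ] at hlow
  rw [add_zero] at hKl
  rw [hKl.2] at hlow
  have hKt := ((TopAt.X_pow (2 * m + 1)).mul (TopAt.one_sub_X_pow (2 * n + 1))).const_mul τ
  have htop := symSqForm_topAt (a := a) (b := -a - m - n) (p := -m) (d := m + n)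
    (by push_cast; ring) (dihedralSum_topAt a m n)
  rw [← hY, hτ, show 2 * (m + n) + 2 = 2 * m + 1 + (2 * n + 1) by ring] at htop
  have htop' := htop.2.symm.trans hKt.2
  have hodd : (-1 : ℂ) ^ (2 * n + 1) = -1 := by rw [pow_succ, pow_mul]; simp
  rw [hodd, dihedralLead_sq] at htop'
  -- The bottom coefficient gives τ = -αγ(2m+1)², the top one -τ = (a-b)² times the squared leading
  -- coefficient of Y. Solving for γ requires α ≠ 0.
  have hγe : γ = dihedralSnd a m n := by
    have h1 : (2 * m + 1 : ℂ) ^ 2 ≠ 0 := pow_ne_zero _ (by exact_mod_cast (2 * m).succ_ne_zero)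
    apply mul_left_cancel₀ ha
    apply mul_right_cancel₀ h1
    change α * dihedralSnd a m n * _ = _ at htop'
    push_cast at hlow
    linear_combination -htop' + hlow
  rw [hYe, hγe]

/-- The formal dihedral identity. -/
theorem dihedral_formal (a : ℂ) (m n : ℕ) :
    C (dihedralFst a m n) * (hypSeries a (-a - m - n) (-m + 1 / 2) *
        hypSeries a (-a - m - n) (-m + 1 / 2)) +
      C (dihedralSnd a m n) * (X ^ (2 * m + 1) *
        (hypSeries (a + m + 1 / 2) (1 / 2 - a - n) ((m + 1 : ℕ) + 1 / 2) *
          hypSeries (a + m + 1 / 2) (1 / 2 - a - n) ((m + 1 : ℕ) + 1 / 2))) =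
      dihedralSum a m n := by
  have hne {a : ℂ} (h : a.im ≠ 0) : dihedralFst a m n ≠ 0 := by
    refine div_ne_zero (mul_ne_zero ?_ ?_)
      (mul_ne_zero (poch_half_ne_zero n) (poch_half_add_ne_zero m n)) <;>
    · refine poch_ne_zero fun i _ h0 => h ?_
      simpa using congrArg Complex.im h0
  by_cases him : a.im = 0
  swap
  · exact dihedral_formal_of_ne (hne him)
  have hc (k : ℕ) : (-m + 1 / 2 + k : ℂ) ≠ 0 := by
    have := half_sub_ne_zero m k
    rwa [show (-m + 1 / 2 + k : ℂ) = 1 / 2 - m + k by ring]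
  ext k
  have hpc {f : ℂ → ℂ} (hf : Continuous f) (j : ℕ) : ContinuousAt (fun a => poch (f a) j) a :=
    ((continuous_poch j).comp hf).continuousAt
  have hF (k : ℕ) : ContinuousAt (fun a => coeff k (hypSeries a (-a - m - n) (-m + 1 / 2))) a :=
    continuousAt_coeff_hypSeries (a := fun a => a) (b := fun a => -a - m - n)
      (c := fun _ => -m + 1 / 2) continuousAt_id (by fun_prop) continuousAt_const hc k
  have hG (k : ℕ) : ContinuousAt (fun a => coeff k
      (hypSeries (a + m + 1 / 2) (1 / 2 - a - n) ((m + 1 : ℕ) + 1 / 2))) a :=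
    continuousAt_coeff_hypSeries (a := fun a => a + m + 1 / 2) (b := fun a => 1 / 2 - a - n)
      (c := fun _ => (m + 1 : ℕ) + 1 / 2) (by fun_prop) (by fun_prop) continuousAt_const
      (natCast_add_half_ne_zero (m + 1)) k
  have h1 : ContinuousAt (fun a => dihedralFst a m n) a := by
    unfold dihedralFst
    exact ((hpc (f := fun a => a + 1 / 2) (by fun_prop) n).mul
      (hpc (f := fun a => a + m + 1 / 2) (by fun_prop) n)).div_const _
  have h2 : ContinuousAt (fun a => dihedralSnd a m n) a := by
    unfold dihedralSnd
    exact (((hpc (f := fun a => a + 1 / 2) (by fun_prop) m).mul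
      (hpc (f := fun a => a + n + 1 / 2) (by fun_prop) m)).mul
      ((hpc (f := fun a => a) (by fun_prop) (m + n + 1)).pow 2)).div_const _
  have hA (i j : ℕ) : ContinuousAt (fun a => dihedralArray a m n i j) a := by
    simp only [dihedralArray, productArray]
    exact ((((hpc (f := fun a => 2 * a) (by fun_prop) _).mul
      (hpc (f := fun a => 2 * (-a - m - n)) (by fun_prop) _)).div
      (hpc (f := fun a => a + (-a - m - n) + 1 / 2) (by fun_prop) _)
      (poch_ne_zero fun i _ => dihedral_lower_ne_zero a m n i)).mul continuousAt_const).mul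
      continuousAt_const
  have hL : ContinuousAt (fun a => coeff k
      (C (dihedralFst a m n) * (hypSeries a (-a - m - n) (-m + 1 / 2) *
        hypSeries a (-a - m - n) (-m + 1 / 2)) +
      C (dihedralSnd a m n) * (X ^ (2 * m + 1) *
        (hypSeries (a + m + 1 / 2) (1 / 2 - a - n) ((m + 1 : ℕ) + 1 / 2) *
          hypSeries (a + m + 1 / 2) (1 / 2 - a - n) ((m + 1 : ℕ) + 1 / 2))))) a := by
    simp only [map_add]
    refine ContinuousAt.add ?_ ?_
    · exact continuousAt_coeff_C_mul (r := fun a => dihedralFst a m n)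
        (f := fun a => hypSeries a (-a - m - n) (-m + 1 / 2) *
          hypSeries a (-a - m - n) (-m + 1 / 2)) h1
        (continuousAt_coeff_mul (f := fun a => hypSeries a (-a - m - n) (-m + 1 / 2))
          (g := fun a => hypSeries a (-a - m - n) (-m + 1 / 2)) hF hF k)
    · refine continuousAt_coeff_C_mul (r := fun a => dihedralSnd a m n)
        (f := fun a => X ^ (2 * m + 1) *
        (hypSeries (a + m + 1 / 2) (1 / 2 - a - n) ((m + 1 : ℕ) + 1 / 2) *
          hypSeries (a + m + 1 / 2) (1 / 2 - a - n) ((m + 1 : ℕ) + 1 / 2))) h2 ?_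
      refine continuousAt_coeff_mul (f := fun _ => X ^ (2 * m + 1))
        (g := fun a => hypSeries (a + m + 1 / 2) (1 / 2 - a - n) ((m + 1 : ℕ) + 1 / 2) *
          hypSeries (a + m + 1 / 2) (1 / 2 - a - n) ((m + 1 : ℕ) + 1 / 2))
        (fun _ => continuousAt_const) (fun k => ?_) k
      exact continuousAt_coeff_mul
        (f := fun a => hypSeries (a + m + 1 / 2) (1 / 2 - a - n) ((m + 1 : ℕ) + 1 / 2))
        (g := fun a => hypSeries (a + m + 1 / 2) (1 / 2 - a - n) ((m + 1 : ℕ) + 1 / 2)) hG hG k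
  have hR : ContinuousAt (fun a => coeff k (dihedralSum a m n)) a :=
    continuousAt_coeff_colSum (A := fun a => dihedralArray a m n) hA _ _ k
  refine eq_of_eq_on_imaginary_shift hL hR fun ε hε => ?_
  rw [dihedral_formal_of_ne (a := a + ε * Complex.I) (hne (by simpa [him] using hε))]

end Dihedral

/-! ### From formal identities to values: convergence near 0. -/

section Evaluation

open PowerSeries

/-- The power series `f` converges at `z`, with sum `w`. -/
def SumsTo (f : ℂ⟦X⟧) (z w : ℂ) : Prop := HasSum (fun k => coeff k f * z ^ k) w

namespace SumsTo

variable {f g : ℂ⟦X⟧} {z v w : ℂ}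

theorem add (hf : SumsTo f z v) (hg : SumsTo g z w) : SumsTo (f + g) z (v + w) := by
  simpa [SumsTo, add_mul] using HasSum.add hf hg

theorem mul (hf : SumsTo f z v) (hg : SumsTo g z w) : SumsTo (f * g) z (v * w) := by
  -- In ℂ summability is absolute, so the Cauchy product is available without further hypotheses.
  have h1 : Summable fun k => ‖coeff k f * z ^ k‖ := hf.summable.norm
  have h2 : Summable fun k => ‖coeff k g * z ^ k‖ := hg.summable.norm
  have hs := (summable_norm_sum_mul_antidiagonal_of_summable_norm h1 h2).of_norm
  have ht := tsum_mul_tsum_eq_tsum_sum_antidiagonal_of_summable_norm h1 h2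
  have he (n : ℕ) : ∑ kl ∈ Finset.HasAntidiagonal.antidiagonal n, coeff kl.1 f * z ^ kl.1 * (coeff kl.2 g * z ^ kl.2) =
      coeff n (f * g) * z ^ n := by
    rw [coeff_mul, Finset.sum_mul]
    refine Finset.sum_congr rfl fun p hp => ?_
    rw [← Finset.HasAntidiagonal.mem_antidiagonal.1 hp, pow_add]
    ring
  simp only [he] at hs ht
  rw [hf.tsum_eq, hg.tsum_eq] at ht
  rw [SumsTo, ht]
  exact hs.hasSum

theorem C_mul (r : ℂ) (hf : SumsTo f z v) : SumsTo (C r * f) z (r * v) := by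
  simpa [SumsTo, coeff_C_mul, mul_assoc] using HasSum.mul_left r hf

theorem one (z : ℂ) : SumsTo 1 z 1 := by
  have := hasSum_single (f := fun k => coeff k (1 : ℂ⟦X⟧) * z ^ k) 0 fun k hk => by
    simp [coeff_one, hk]
  simpa [SumsTo] using this

theorem X (z : ℂ) : SumsTo X z z := by
  have := hasSum_single (f := fun k => coeff k (PowerSeries.X : ℂ⟦X⟧) * z ^ k) 1 fun k hk => by
    simp [coeff_X, hk]
  simpa [SumsTo] using this

theorem neg (hf : SumsTo f z v) : SumsTo (-f) z (-v) := by
  simpa [SumsTo] using HasSum.neg hf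

theorem one_sub_X (z : ℂ) : SumsTo (1 - PowerSeries.X) z (1 - z) := by
  rw [sub_eq_add_neg, sub_eq_add_neg]
  exact (one z).add (X z).neg

theorem pow (hf : SumsTo f z v) (n : ℕ) : SumsTo (f ^ n) z (v ^ n) := by
  induction n with
  | zero => simpa using one z
  | succ n ih => rw [pow_succ, pow_succ]; exact ih.mul hf

theorem sum {ι : Type*} {s : Finset ι} {f : ι → ℂ⟦X⟧} {v : ι → ℂ}
    (hf : ∀ i ∈ s, SumsTo (f i) z (v i)) : SumsTo (∑ i ∈ s, f i) z (∑ i ∈ s, v i) := by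
  have := hasSum_sum hf
  simpa [SumsTo, Finset.sum_mul] using this

theorem unique (hf : SumsTo f z v) (hg : SumsTo f z w) : v = w := HasSum.unique hf hg

theorem geometric {z : ℂ} (hz : ‖z‖ < 1) : SumsTo (mk 1) z (1 - z)⁻¹ := by
  simpa [SumsTo] using hasSum_geometric_of_norm_lt_one hz

end SumsTo

theorem eventually_norm_mul_lt (M : ℝ) {r : ℝ} (hr : 0 < r) : ∀ᶠ z : ℂ in 𝓝 0, M * ‖z‖ < r := by
  have : Tendsto (fun z : ℂ => M * ‖z‖) (𝓝 0) (𝓝 0) := by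
    have h : Continuous fun z : ℂ => M * ‖z‖ := by fun_prop
    simpa using h.tendsto 0
  exact this.eventually_lt_const hr

theorem eventually_summable_of_ratio {u r : ℕ → ℂ} {L : ℂ}
    (hu : ∀ᶠ i in atTop, u (i + 1) = r i * u i) (hr : Tendsto r atTop (𝓝 L)) :
    ∀ᶠ z : ℂ in 𝓝 0, Summable fun i => u i * z ^ i := by
  filter_upwards [eventually_norm_mul_lt (‖L‖ + 1) (one_half_pos (α := ℝ))] with z hz
  refine summable_of_ratio_norm_eventually_le one_half_lt_one ?_
  have hb : ∀ᶠ i in atTop, ‖r i‖ < ‖L‖ + 1 :=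
    hr.norm.eventually_lt_const (lt_add_one _)
  filter_upwards [hu, hb] with i h1 h2
  rw [h1, pow_succ, show r i * u i * (z ^ i * z) = (r i * z) * (u i * z ^ i) by ring, norm_mul]
  refine mul_le_mul_of_nonneg_right ?_ (norm_nonneg _)
  rw [norm_mul]
  exact (mul_le_mul_of_nonneg_right h2.le (norm_nonneg _)).trans hz.le

theorem tendsto_shift_ratio (a b : ℂ) :
    Tendsto (fun k : ℕ => (a + k) / (b + k)) atTop (𝓝 1) := by
  simpa using tendsto_add_mul_div_add_mul_atTop_nhds a b 1 (one_ne_zero (α := ℂ))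

theorem hypSeries_sumsTo {a b c : ℂ} (hc : ∀ k : ℕ, c + k ≠ 0) :
    ∀ᶠ z : ℂ in 𝓝 0, SumsTo (hypSeries a b c) z (ordinaryHypergeometric a b c z) := by
  have hr : Tendsto (fun k : ℕ => (a + k) / (c + k) * ((b + k) / (1 + k))) atTop (𝓝 (1 * 1)) :=
    (tendsto_shift_ratio a c).mul (tendsto_shift_ratio b 1)
  have hu : ∀ᶠ k : ℕ in atTop, coeff (k + 1) (hypSeries a b c) =
      (a + k) / (c + k) * ((b + k) / (1 + k)) * coeff k (hypSeries a b c) :=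
    Eventually.of_forall fun k => by
      have h1 := hc k
      have h2 : (1 + k : ℂ) ≠ 0 := by rw [add_comm]; exact_mod_cast k.succ_ne_zero
      have h := coeff_hypSeries_succ (a := a) (b := b) hc k
      rw [div_mul_div_comm, div_mul_eq_mul_div, eq_div_iff (mul_ne_zero h1 h2), ← h]
      ring
  filter_upwards [eventually_summable_of_ratio (u := fun k => coeff k (hypSeries a b c)) hu hr] with z hz
  have he : ordinaryHypergeometric a b c z = ∑' k, coeff k (hypSeries a b c) * z ^ k := by
    rw [ordinaryHypergeometric_eq_tsum]
    refine tsum_congr fun k => ?_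
    simp only [hypSeries, coeff_mk, poch, smul_eq_mul, div_eq_mul_inv, mul_inv]
    ring
  rw [SumsTo, he]
  exact hz.hasSum

theorem binomial_sumsTo (s : ℂ) :
    ∀ᶠ z : ℂ in 𝓝 0, SumsTo (hypSeries s 1 1) z (1 / (1 - z) ^ s) := by
  have h := (Complex.one_div_one_sub_cpow_hasFPowerSeriesOnBall_zero s).hasFPowerSeriesAt
  have h := h.eventually_hasSum
  filter_upwards [h] with z hz
  rw [zero_add] at hz
  refine (congrArg (fun F : ℕ → ℂ => HasSum F (1 / (1 - z) ^ s)) (funext fun n => ?_)).mpr hz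
  have hn : (n.factorial : ℂ) ≠ 0 := by exact_mod_cast n.factorial_ne_zero
  have hc : Ring.choose (s + n - 1) n = poch s n / n.factorial := by
    have h := Ring.factorial_nsmul_multichoose_eq_ascPochhammer s n
    rw [Ring.choose, show s + n - 1 - n + 1 = s by ring, poch, eq_div_iff hn, mul_comm,
      ← nsmul_eq_mul, h, Polynomial.ascPochhammer_smeval_eq_eval]
  have hk : coeff n (hypSeries s 1 1) = poch s n / n.factorial := by
    rw [hypSeries, coeff_mk, poch_one]
    field_simp
  simp [hk, hc, mul_comm]

theorem sumsTo_colSum {A : ℕ → ℕ → ℂ} {N : ℕ} {z : ℂ} {s : ℕ → ℂ}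
    (hs : ∀ j < N, HasSum (fun i => A i j * z ^ i) (s j)) :
    SumsTo (colSum (1 - X) N A) z (∑ j ∈ Finset.range N, (1 - z) ^ j * s j) := by
  rw [colSum_apply]
  refine SumsTo.sum fun j hj => ((SumsTo.one_sub_X z).pow j).mul ?_
  simpa [SumsTo] using hs j (Finset.mem_range.1 hj)

/-- Only finitely many columns are nonzero, so no smallness of y is needed; this matters for y =
1-z, which is near 1. -/
theorem hasSum_doubleTerm {A : ℕ → ℕ → ℂ} {N : ℕ} {x y : ℂ} {s : ℕ → ℂ}
    (hA : ∀ i j, N ≤ j → A i j = 0) (hs : ∀ j < N, HasSum (fun i => A i j * x ^ i) (s j)) :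
    HasSum (doubleTerm A x y) (∑ j ∈ Finset.range N, y ^ j * s j) := by
  have hcol (j : ℕ) (hj : j ∈ Finset.range N) :
      HasSum (fun p : ℕ × ℕ => if p.2 = j then doubleTerm A x y p else 0) (y ^ j * s j) := by
    have hinj : Function.Injective fun i : ℕ => (i, j) := fun i i' h => by simpa using h
    refine (hinj.hasSum_iff fun p hp => if_neg ?_).1 ?_
    · rintro rfl
      exact hp ⟨p.1, rfl⟩
    · have := (hs j (Finset.mem_range.1 hj)).mul_left (y ^ j)
      refine (congrArg (fun F : ℕ → ℂ => HasSum F (y ^ j * s j)) (funext fun i => ?_)).mp this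
      simp [doubleTerm]
      ring
  have := hasSum_sum hcol
  convert this using 1
  funext p
  rw [Finset.sum_ite_eq]
  split_ifs with h
  · rfl
  · rw [doubleTerm, hA _ _ (by simpa using h)]
    ring

end Evaluation

/-! ### Absolute convergence of the double series on y = z/(z-1). -/

section DoubleEvaluation

open PowerSeries

theorem norm_coeff_X_pow_mul_pow (i j n : ℕ) :
    ((‖coeff n (X ^ i * (-X * mk 1) ^ j : ℂ⟦X⟧)‖ : ℝ) : ℂ) = coeff n (X ^ i * (X * mk 1) ^ j : ℂ⟦X⟧) := by
  have h : (X ^ i * (X * mk 1) ^ j : ℂ⟦X⟧) = map (Nat.castRingHom ℂ) (X ^ i * (X * mk 1) ^ j) := by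
    have h1 : map (Nat.castRingHom ℂ) (mk 1) = mk 1 := by ext; simp
    simp [h1]
  have h' : (X ^ i * (-X * mk 1) ^ j : ℂ⟦X⟧) = C ((-1) ^ j) * (X ^ i * (X * mk 1) ^ j) := by
    rw [show (-X * mk 1 : ℂ⟦X⟧) = -1 * (X * mk 1) by ring, mul_pow, map_pow, map_neg, map_one]
    ring
  rw [h', coeff_C_mul, h, coeff_map]
  simp

/-- Up to one overall sign the coefficients are nonnegative, so the norms sum to the value at |z| of
X^i (X/(1-X))^j. -/
theorem hasSum_norm_coeff (i j : ℕ) {z : ℂ} (hz : ‖z‖ < 1) :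
    HasSum (fun n => ‖coeff n (X ^ i * (-X * mk 1) ^ j : ℂ⟦X⟧) * z ^ n‖)
      (‖z‖ ^ i * (‖z‖ / (1 - ‖z‖)) ^ j) := by
  have hx : ‖(‖z‖ : ℂ)‖ < 1 := by simpa using hz
  have h := ((SumsTo.X (‖z‖ : ℂ)).pow i).mul (((SumsTo.X (‖z‖ : ℂ)).mul (SumsTo.geometric hx)).pow j)
  rw [← Complex.hasSum_ofReal]
  rw [SumsTo, ← div_eq_mul_inv] at h
  push_cast
  refine (congrArg (fun F : ℕ → ℂ => HasSum F (‖z‖ ^ i * (‖z‖ / (1 - ‖z‖)) ^ j))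
    (funext fun n => ?_)).mp h
  rw [norm_mul, norm_pow, Complex.ofReal_mul, norm_coeff_X_pow_mul_pow, Complex.ofReal_pow]

theorem sumsTo_X_pow_mul_pow (i j : ℕ) {z : ℂ} (hz : ‖z‖ < 1) :
    SumsTo (X ^ i * (-X * mk 1) ^ j) z (z ^ i * (z / (z - 1)) ^ j) := by
  have h := ((SumsTo.X z).pow i).mul (((SumsTo.X z).neg.mul (SumsTo.geometric hz)).pow j)
  rwa [show -z * (1 - z)⁻¹ = z / (z - 1) by
    rw [div_eq_mul_inv, ← neg_sub 1 z, inv_neg]; ring] at h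

theorem hasSum_coeff_diagSum (A : ℕ → ℕ → ℂ) (n : ℕ) (z : ℂ) :
    HasSum (fun p : ℕ × ℕ => A p.1 p.2 * (coeff n (X ^ p.1 * (-X * mk 1) ^ p.2 : ℂ⟦X⟧) * z ^ n))
      (coeff n (diagSum (-X * mk 1) A) * z ^ n) := by
  have hX : (X : ℂ⟦X⟧) ∣ -X * mk 1 := ⟨-mk 1, by ring⟩
  have hd (p : ℕ × ℕ) (hp : p ∉ Finset.range (n + 1) ×ˢ Finset.range (n + 1)) :
      A p.1 p.2 * (coeff n (X ^ p.1 * (-X * mk 1) ^ p.2 : ℂ⟦X⟧) * z ^ n) = 0 := by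
    have : coeff n (X ^ p.1 * (-X * mk 1) ^ p.2 : ℂ⟦X⟧) = 0 := by
      rcases lt_or_ge n p.1 with h | h
      · exact X_pow_dvd_iff.1 (dvd_mul_right _ _) n h
      · refine X_pow_dvd_iff.1 (dvd_mul_of_dvd_right (pow_dvd_pow_of_dvd hX p.2) _) n ?_
        simp at hp
        exact hp (by omega)
    rw [this]
    ring
  refine (congrArg (HasSum _) ?_).mpr (hasSum_sum_of_ne_finset_zero hd)
  rw [coeff_diagSum hX A (Nat.lt_succ_self n), colSum_apply, map_sum, Finset.sum_mul,
    Finset.sum_product_right]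
  refine Finset.sum_congr rfl fun j _ => ?_
  rw [mul_comm ((-X * mk 1 : ℂ⟦X⟧) ^ j), coeff_mul,
    Finset.Nat.sum_antidiagonal_eq_sum_range_succ_mk, Finset.sum_mul]
  refine Finset.sum_congr rfl fun i hi => ?_
  rw [coeff_X_pow_mul', if_pos (by simpa [Nat.lt_succ_iff] using hi), coeff_mk]
  ring

theorem diagSum_sumsTo {A : ℕ → ℕ → ℂ} {M : ℝ} (hM : 0 ≤ M) (hA : ∀ i j, ‖A i j‖ ≤ M ^ (i + j))
    {z : ℂ} (hz : (M + 1) * ‖z‖ < 1) :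
    Summable (doubleTerm A z (z / (z - 1))) ∧
      SumsTo (diagSum (-X * mk 1) A) z (doubleSeries A z (z / (z - 1))) := by
  have hMz : 0 ≤ M * ‖z‖ := by positivity
  have hz1 : ‖z‖ < 1 := by nlinarith
  have h1 : M * ‖z‖ < 1 := by nlinarith [norm_nonneg z]
  have h1z : 0 < 1 - ‖z‖ := by linarith
  have h2 : M * (‖z‖ / (1 - ‖z‖)) < 1 := by
    rw [mul_div_assoc', div_lt_one h1z]
    linarith
  -- The powers of y are expanded too, giving a triple family. Absolute summability allows summing
  -- over n first (the double series) or over (i,j) first (the power series); (M+1)|z| < 1 is what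
  -- makes M|z|/(1-|z|) < 1.
  set f : (ℕ × ℕ) × ℕ → ℂ := fun q =>
    A q.1.1 q.1.2 * (coeff q.2 (X ^ q.1.1 * (-X * mk 1) ^ q.1.2 : ℂ⟦X⟧) * z ^ q.2) with hf
  have hrow (p : ℕ × ℕ) : HasSum (fun n => ‖f (p, n)‖)
      (‖A p.1 p.2‖ * (‖z‖ ^ p.1 * (‖z‖ / (1 - ‖z‖)) ^ p.2)) := by
    simpa only [hf, norm_mul (A _ _)] using (hasSum_norm_coeff p.1 p.2 hz1).mul_left ‖A p.1 p.2‖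
  have hs : Summable f := by
    refine Summable.of_norm ((summable_prod_of_nonneg fun q => norm_nonneg _).2
      ⟨fun p => (hrow p).summable, ?_⟩)
    simp only [(hrow _).tsum_eq]
    have hg := (summable_geometric_of_lt_one hMz h1).mul_of_nonneg
      (summable_geometric_of_lt_one (by positivity) h2) (fun i => by positivity)
      (fun j => by positivity)
    refine hg.of_nonneg_of_le (fun p => by positivity) fun p => ?_
    calc _ ≤ M ^ (p.1 + p.2) * (‖z‖ ^ p.1 * (‖z‖ / (1 - ‖z‖)) ^ p.2) :=
          mul_le_mul_of_nonneg_right (hA _ _) (by positivity)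
      _ = _ := by rw [mul_pow, mul_pow, pow_add]; ring
  have hp : HasSum (doubleTerm A z (z / (z - 1))) (∑' q, f q) :=
    hs.hasSum.prod_fiberwise fun p => by
      have := (sumsTo_X_pow_mul_pow p.1 p.2 hz1).mul_left (A p.1 p.2)
      rwa [← mul_assoc] at this
  have hn : SumsTo (diagSum (-X * mk 1) A) z (∑' q, f q) :=
    ((Equiv.prodComm ℕ (ℕ × ℕ)).hasSum_iff.2 hs.hasSum).prod_fiberwise fun n =>
      hasSum_coeff_diagSum A n z
  rw [doubleSeries, hp.tsum_eq]
  exact ⟨hp.summable, hn⟩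

theorem exists_norm_le_pow {u r : ℕ → ℂ} {L : ℂ} (h0 : u 0 = 1) (hu : ∀ k, u (k + 1) = r k * u k)
    (hr : Tendsto r atTop (𝓝 L)) : ∃ K : ℝ, 1 ≤ K ∧ ∀ k, ‖u k‖ ≤ K ^ k := by
  obtain ⟨B, hB⟩ := (Metric.isBounded_range_of_tendsto r hr).exists_norm_le
  refine ⟨max 1 B, le_max_left _ _, fun k => ?_⟩
  induction k with
  | zero => simp [h0]
  | succ k ih =>
    rw [hu, norm_mul, pow_succ, mul_comm]
    exact mul_le_mul ih ((hB _ ⟨k, rfl⟩).trans (le_max_right _ _)) (norm_nonneg _) (by positivity)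

theorem exists_norm_poch_div_factorial_le (a : ℂ) :
    ∃ K : ℝ, 1 ≤ K ∧ ∀ k, ‖poch a k / k.factorial‖ ≤ K ^ k := by
  refine exists_norm_le_pow (by simp) (fun k => ?_) (tendsto_shift_ratio a 1)
  have h2 : (1 + k : ℂ) ≠ 0 := by rw [add_comm]; exact_mod_cast k.succ_ne_zero
  have h3 : (k.factorial : ℂ) ≠ 0 := by exact_mod_cast k.factorial_ne_zero
  rw [poch_succ, Nat.factorial_succ]
  push_cast
  rw [add_comm (k : ℂ) 1]
  field_simp

theorem exists_norm_factorial_div_poch_le {c : ℂ} (hc : ∀ k : ℕ, c + k ≠ 0) :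
    ∃ K : ℝ, 1 ≤ K ∧ ∀ k, ‖(k.factorial : ℂ) / poch c k‖ ≤ K ^ k := by
  refine exists_norm_le_pow (by simp) (fun k => ?_) (tendsto_shift_ratio 1 c)
  have h2 := hc k
  have h3 : poch c k ≠ 0 := poch_ne_zero fun i _ => hc i
  rw [poch_succ, Nat.factorial_succ]
  push_cast
  rw [add_comm (k : ℂ) 1]
  field_simp

theorem exists_norm_coeff122_le (a p₁ p₂ q₁ q₂ : ℂ) {b c : ℂ} (hb : ∀ k : ℕ, b + k ≠ 0)
    (hc : ∀ k : ℕ, c + k ≠ 0) :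
    ∃ M : ℝ, 0 ≤ M ∧ ∀ i j, ‖coeff122 a p₁ p₂ q₁ q₂ b c i j‖ ≤ M ^ (i + j) := by
  obtain ⟨Ka, ha1, ha⟩ := exists_norm_poch_div_factorial_le a
  obtain ⟨K₁, h11, h1⟩ := exists_norm_poch_div_factorial_le p₁
  obtain ⟨K₂, h21, h2⟩ := exists_norm_poch_div_factorial_le p₂
  obtain ⟨K₃, h31, h3⟩ := exists_norm_poch_div_factorial_le q₁
  obtain ⟨K₄, h41, h4⟩ := exists_norm_poch_div_factorial_le q₂
  obtain ⟨Kb, hb1, hb'⟩ := exists_norm_factorial_div_poch_le hb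
  obtain ⟨Kc, hc1, hc'⟩ := exists_norm_factorial_div_poch_le hc
  refine ⟨Ka * Kb * Kc * K₁ * K₂ * K₃ * K₄, by positivity, fun i j => ?_⟩
  have hi : (i.factorial : ℂ) ≠ 0 := by exact_mod_cast i.factorial_ne_zero
  have hj : (j.factorial : ℂ) ≠ 0 := by exact_mod_cast j.factorial_ne_zero
  have hij : ((i + j).factorial : ℂ) ≠ 0 := by exact_mod_cast (i + j).factorial_ne_zero
  have hb0 : poch b (i + j) ≠ 0 := poch_ne_zero fun i _ => hb i
  have hc0 : poch c (i + j) ≠ 0 := poch_ne_zero fun i _ => hc i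
  have hfac : ‖((i.factorial : ℂ) * j.factorial) / (i + j).factorial‖ ≤ 1 := by
    have h : (i.factorial * j.factorial : ℝ) ≤ (i + j).factorial := by
      exact_mod_cast Nat.le_of_dvd (Nat.factorial_pos _) (Nat.factorial_mul_factorial_dvd_factorial_add i j)
    rw [norm_div, norm_mul]
    simp only [Complex.norm_natCast]
    exact div_le_one_of_le₀ h (by positivity)
  -- Each Pochhammer symbol is paired with a factorial so that every quotient grows at most
  -- geometrically; the leftover is an inverse binomial coefficient, at most 1.
  have e : coeff122 a p₁ p₂ q₁ q₂ b c i j =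
      poch a (i + j) / (i + j).factorial * ((i + j).factorial / poch b (i + j)) *
        ((i + j).factorial / poch c (i + j)) * (poch p₁ i / i.factorial) *
        (poch p₂ j / j.factorial) * (poch q₁ i / i.factorial) * (poch q₂ j / j.factorial) *
        (((i.factorial : ℂ) * j.factorial) / (i + j).factorial) := by
    rw [coeff122]
    field_simp
  rw [e, ← mul_one ((_ : ℝ) ^ (i + j))]
  simp only [norm_mul _ (_ / _), mul_pow]
  have hl {K : ℝ} (hK : 1 ≤ K) {x : ℝ} (h : x ≤ K ^ i) : x ≤ K ^ (i + j) :=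
    h.trans (pow_le_pow_right₀ hK (by omega))
  have hr {K : ℝ} (hK : 1 ≤ K) {x : ℝ} (h : x ≤ K ^ j) : x ≤ K ^ (i + j) :=
    h.trans (pow_le_pow_right₀ hK (by omega))
  gcongr
  · exact ha _
  · exact hb' _
  · exact hc' _
  · exact hl h11 (h1 i)
  · exact hr h21 (h2 j)
  · exact hl h31 (h3 i)
  · exact hr h41 (h4 j)

theorem chaundy_eventually {a b c : ℂ} (hc : ∀ k : ℕ, c ≠ -(k : ℂ))
    (hc' : ∀ k : ℕ, 2 - c ≠ -(k : ℂ)) :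
    ∀ᶠ z : ℂ in 𝓝 0,
      Summable (doubleTerm
        (coeff122 (1 / 2) (a - b + 1 / 2) (a + b - c + 1 / 2)
          (b - a + 1 / 2) (c - a - b + 1 / 2) c (2 - c)) z (z / (z - 1))) ∧
      ordinaryHypergeometric a b c z *
          ordinaryHypergeometric (1 + a - c) (1 + b - c) (2 - c) z =
        (1 - z) ^ (c - a - b - 1 / 2) *
          doubleSeries
            (coeff122 (1 / 2) (a - b + 1 / 2) (a + b - c + 1 / 2)
              (b - a + 1 / 2) (c - a - b + 1 / 2) c (2 - c)) z (z / (z - 1)) := by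
  have hcn := add_ne_zero_of_ne_neg hc
  have hcn' := add_ne_zero_of_ne_neg hc'
  obtain ⟨M, hM, hA⟩ := exists_norm_coeff122_le (1 / 2) (a - b + 1 / 2) (a + b - c + 1 / 2)
    (b - a + 1 / 2) (c - a - b + 1 / 2) hcn hcn'
  filter_upwards [eventually_norm_mul_lt (M + 1) one_pos, eventually_norm_mul_lt 1 one_pos,
    binomial_sumsTo (c - a - b - 1 / 2), hypSeries_sumsTo (a := a) (b := b) hcn,
    hypSeries_sumsTo (a := 1 + a - c) (b := 1 + b - c) hcn'] with z hz hz1 h0 h1 h2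
  obtain ⟨hs, h3⟩ := diagSum_sumsTo hM hA hz
  refine ⟨hs, ?_⟩
  rw [← chaundy_formal hc hc'] at h3
  rw [← (h0.mul (h1.mul h2)).unique h3]
  have hne : 1 - z ≠ 0 := sub_ne_zero.2 fun h => by simp [← h] at hz1
  have : (1 - z) ^ (c - a - b - 1 / 2) ≠ 0 := by simp [Complex.cpow_eq_zero_iff, hne]
  rw [← mul_assoc, mul_one_div_cancel this, one_mul]

end DoubleEvaluation

/-! ### Evaluation of the terminating series and limits of their coefficients. -/

section TerminatingEvaluation

open PowerSeries

theorem eventually_natCast_add_ne_zero (a : ℂ) : ∀ᶠ k : ℕ in atTop, a + k ≠ 0 := by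
  obtain ⟨N, hN⟩ := exists_nat_gt ‖a‖
  filter_upwards [eventually_ge_atTop N] with k hk h
  have h1 : ‖a‖ = k := by rw [eq_neg_of_add_eq_zero_left h, norm_neg, Complex.norm_natCast]
  have : (N : ℝ) ≤ k := by exact_mod_cast hk
  linarith

theorem eventually_summable_clausenArray {a b : ℂ} {n : ℕ} (hc : ∀ k : ℕ, a + b + 1 / 2 + k ≠ 0)
    (j : ℕ) : ∀ᶠ z : ℂ in 𝓝 0, Summable fun i => clausenArray a b n i j * z ^ i := by
  have hw (k : ℕ) : a + b + n + 1 / 2 + k ≠ 0 := by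
    have := hc (n + k)
    push_cast at this
    rwa [show a + b + n + 1 / 2 + k = a + b + 1 / 2 + (n + k) by ring]
  refine eventually_summable_of_ratio (u := fun i => clausenArray a b n i j) ?_
    (((tendsto_shift_ratio (2 * a + j) (a + b + 1 / 2 + j)).mul
      (tendsto_shift_ratio (2 * b + j) (2 * (a + b + n)))).mul
      (tendsto_shift_ratio (a + b + n) 1))
  -- In the exceptional case 2p+i vanishes for some i, so the ratio is available only for large i,
  -- which is enough.
  filter_upwards [eventually_natCast_add_ne_zero (2 * (a + b + n))] with i hi
  have h := productArray_succ_fst (s := termRatio n) hc (dupRatio_succ hw) i j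
  have h1 := hc (i + j)
  have h2 : (1 + i : ℂ) ≠ 0 := by rw [add_comm]; exact_mod_cast i.succ_ne_zero
  push_cast at h h1
  rw [add_comm (i : ℂ) j, ← add_assoc] at h1
  change clausenArray a b n (i + 1) j * _ = _ * clausenArray a b n i j at h
  rw [div_mul_div_comm, div_mul_div_comm, div_mul_eq_mul_div,
    eq_div_iff (mul_ne_zero (mul_ne_zero h1 hi) h2)]
  linear_combination h

theorem poch_two_mul_ne_zero {a b : ℂ} {n : ℕ} (hc : ∀ k : ℕ, a + b + 1 / 2 + k ≠ 0)
    (hp : ∀ k : ℕ, a + b + n + k ≠ 0) (i : ℕ) : poch (2 * (a + b + n)) i ≠ 0 := by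
  refine poch_ne_zero fun k _ h => ?_
  obtain ⟨l, rfl | rfl⟩ := Nat.even_or_odd' k
  · refine hp l ?_
    push_cast at h
    linear_combination h / 2
  · refine hc (n + l) ?_
    push_cast at h ⊢
    linear_combination h / 2

theorem clausenCoeff_eq {a b : ℂ} {n : ℕ} (hw : ∀ k : ℕ, a + b + n + 1 / 2 + k ≠ 0) {i j : ℕ}
    (hi : poch (2 * (a + b + n)) i ≠ 0) (hj : j ≤ n) :
    clausenCoeff a b n i j = clausenArray a b n i j := by
  rw [clausenCoeff, coeff211, clausenArray, productArray, dupRatio_eq hw hi, termRatio, if_pos hj,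
    show 2 * a + 2 * b + 2 * n = 2 * (a + b + n) by ring]
  simp only [div_eq_mul_inv, mul_inv]
  ring

theorem clausenArray_of_lt (a b : ℂ) {n : ℕ} (i : ℕ) {j : ℕ} (hj : n < j) :
    clausenArray a b n i j = 0 := by
  simp [clausenArray, productArray, termRatio_of_lt hj]

theorem terminateSnd_clausenArray (a b : ℂ) (n : ℕ) :
    terminateSnd n (clausenArray a b n) = clausenArray a b n := by
  funext i j
  rw [terminateSnd]
  split_ifs with h
  · rfl
  · rw [clausenArray_of_lt _ _ _ (not_le.1 h)]

theorem clausen_eventually {a b : ℂ} {n : ℕ} (hc : ∀ k : ℕ, a + b + 1 / 2 + k ≠ 0) :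
    ∀ᶠ z : ℂ in 𝓝 0,
      Summable (doubleTerm (clausenArray a b n) z (1 - z)) ∧
      poch (a + 1 / 2) n * poch (b + 1 / 2) n *
          ordinaryHypergeometric a b (a + b + n + 1 / 2) z ^ 2 =
        poch (1 / 2) n * poch (a + b + 1 / 2) n *
          doubleSeries (clausenArray a b n) z (1 - z) ∧
      (poch (a + 1 / 2) n ≠ 0 → poch (b + 1 / 2) n ≠ 0 →
        ordinaryHypergeometric a b (a + b + n + 1 / 2) z ^ 2 =
          (poch (1 / 2) n * poch (a + b + 1 / 2) n) /
              (poch (a + 1 / 2) n * poch (b + 1 / 2) n) *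
            doubleSeries (clausenArray a b n) z (1 - z)) := by
  have hw (k : ℕ) : a + b + n + 1 / 2 + k ≠ 0 := by
    have := hc (n + k)
    push_cast at this
    rwa [show a + b + n + 1 / 2 + k = a + b + 1 / 2 + (n + k) by ring]
  filter_upwards [hypSeries_sumsTo (a := a) (b := b) hw,
    (eventually_all_finset (Finset.range (n + 2))).2 fun j _ =>
      eventually_summable_clausenArray (n := n) hc j] with z h1 h2
  have hcol (j : ℕ) (hj : j < n + 2) :
      HasSum (fun i => clausenArray a b n i j * z ^ i) (∑' i, clausenArray a b n i j * z ^ i) :=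
    (h2 j (Finset.mem_range.2 hj)).hasSum
  have hd := hasSum_doubleTerm (y := 1 - z)
    (fun i j (hj : n + 2 ≤ j) => clausenArray_of_lt a b (n := n) i (by omega)) hcol
  have hs := (sumsTo_colSum hcol).C_mul (poch (1 / 2) n * poch (a + b + 1 / 2) n)
  rw [← clausen_formal hc] at hs
  have he := ((h1.mul h1).C_mul (poch (a + 1 / 2) n * poch (b + 1 / 2) n)).unique hs
  rw [← pow_two, ← hd.tsum_eq] at he
  refine ⟨hd.summable, he, fun ha hb => ?_⟩
  rw [div_mul_eq_mul_div, eq_div_iff (mul_ne_zero ha hb), mul_comm]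
  exact he

theorem eventually_poch_two_mul_ne_zero (a b : ℂ) (n : ℕ) {m : ℕ} (h : a + b + n = -(m : ℂ)) :
    ∀ᶠ b' : ℂ in 𝓝[≠] b, ∀ i, poch (2 * (a + b' + n)) i ≠ 0 := by
  filter_upwards [self_mem_nhdsWithin,
    mem_nhdsWithin_of_mem_nhds (Metric.ball_mem_nhds b (one_half_pos (α := ℝ)))] with b' h1 h2 i
  refine poch_ne_zero fun k _ hk => h1 ?_
  -- A vanishing factor makes 2(b'-b) an integer, and the radius 1/2 forces it to be 0.
  have e : 2 * (b' - b) = ((2 * m - k : ℤ) : ℂ) := by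
    push_cast
    linear_combination hk - 2 * h
  have hlt : ‖((2 * m - k : ℤ) : ℂ)‖ < 1 := by
    rw [← e, norm_mul, Complex.norm_ofNat, ← dist_eq_norm]
    rw [Metric.mem_ball] at h2
    linarith
  rw [Complex.norm_intCast] at hlt
  have h0 : (2 * m - k : ℤ) = 0 := Int.abs_lt_one_iff.1 (by exact_mod_cast hlt)
  rw [h0] at e
  have : b' - b = 0 := by simpa using e
  exact sub_eq_zero.1 this

theorem tendsto_clausenCoeff {a b : ℂ} {n m : ℕ} (h : a + b + n = -(m : ℂ))
    (hc : ∀ k : ℕ, a + b + 1 / 2 + k ≠ 0) (i : ℕ) {j : ℕ} (hj : j ≤ n) :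
    Tendsto (fun b' : ℂ => clausenCoeff a b' n i j) (𝓝[≠] b) (𝓝 (clausenArray a b n i j)) := by
  refine Tendsto.congr' ?_ ((continuousAt_clausenArray (n := n) hc i j).tendsto.mono_left
    nhdsWithin_le_nhds)
  filter_upwards [eventually_poch_two_mul_ne_zero a b n h] with b' hb'
  refine (clausenCoeff_eq (fun k hk => ?_) (hb' i) hj).symm
  -- If w+1/2+k = 0 for w = a+b'+n, then 2w+(2k+1) = 0 is the last factor of (2w)_(2k+2).
  refine hb' (2 * k + 2) ?_
  rw [poch_succ]
  push_cast
  rw [show 2 * (a + b' + n) + (2 * k + 1) = 0 by linear_combination 2 * hk, mul_zero]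

theorem rectSum_eq {A B : ℕ → ℕ → ℂ} {M N : ℕ} (h : ∀ i ≤ M, ∀ j ≤ N, A i j = B i j) (x y : ℂ) :
    rectSum M N A x y = rectSum M N B x y :=
  Finset.sum_congr rfl fun i hi => Finset.sum_congr rfl fun j hj => by
    rw [h i (by simpa [Nat.lt_succ_iff] using hi) j (by simpa [Nat.lt_succ_iff] using hj)]

theorem dihedralArray_eq (a : ℂ) {m n i j : ℕ} (hi : i ≤ m) (hj : j ≤ n) :
    coeff211 (2 * a) (-(2 * a) - 2 * m - 2 * n) (-m) (-n)
      (1 / 2 - m - n) (-(2 * m)) (-(2 * n)) i j = dihedralArray a m n i j := by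
  rw [coeff211, dihedralArray, productArray, termRatio, termRatio, if_pos hi, if_pos hj,
    show a + (-a - m - n) + 1 / 2 = 1 / 2 - m - n by ring,
    show 2 * (-a - m - n) = -(2 * a) - 2 * m - 2 * n by ring]
  simp only [div_eq_mul_inv, mul_inv]
  ring

theorem dihedralSum_sumsTo (a : ℂ) (m n : ℕ) (z : ℂ) :
    SumsTo (dihedralSum a m n) z (rectSum m n (dihedralArray a m n) z (1 - z)) := by
  have h := sumsTo_colSum (A := dihedralArray a m n) (N := n + 2) (z := z)
    (s := fun j => ∑ i ∈ Finset.range (m + 1), dihedralArray a m n i j * z ^ i)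
    fun j _ => hasSum_sum_of_ne_finset_zero fun i hi => by
      simp [dihedralArray, productArray, termRatio_of_lt (show m < i by simpa using hi)]
  have e : rectSum m n (dihedralArray a m n) z (1 - z) = ∑ j ∈ Finset.range (n + 2),
      (1 - z) ^ j * ∑ i ∈ Finset.range (m + 1), dihedralArray a m n i j * z ^ i := by
    have h0 (i : ℕ) : dihedralArray a m n i (n + 1) = 0 := by
      simp [dihedralArray, productArray, termRatio_of_lt]
    rw [rectSum, Finset.sum_comm, Finset.sum_range_succ _ (n + 1)]
    simp only [h0, zero_mul, Finset.sum_const_zero, mul_zero, add_zero]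
    refine Finset.sum_congr rfl fun j _ => ?_
    rw [Finset.mul_sum]
    exact Finset.sum_congr rfl fun i _ => by ring
  rw [e]
  exact h

theorem dihedral_eventually (a : ℂ) (m n : ℕ) :
    ∀ᶠ z : ℂ in 𝓝 0,
      dihedralFst a m n * ordinaryHypergeometric a (-a - m - n) (1 / 2 - m) z ^ 2 +
        dihedralSnd a m n * z ^ (2 * m + 1) *
          ordinaryHypergeometric (a + m + 1 / 2) (1 / 2 - a - n) (m + 3 / 2) z ^ 2 =
      rectSum m n (dihedralArray a m n) z (1 - z) := by
  have hc (k : ℕ) : (-m + 1 / 2 + k : ℂ) ≠ 0 := by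
    have := half_sub_ne_zero m k
    rwa [show (-m + 1 / 2 + k : ℂ) = 1 / 2 - m + k by ring]
  filter_upwards [hypSeries_sumsTo (a := a) (b := -a - m - n) hc,
    hypSeries_sumsTo (a := a + m + 1 / 2) (b := 1 / 2 - a - n) (natCast_add_half_ne_zero (m + 1))]
    with z h1 h2
  have h := ((h1.mul h1).C_mul (dihedralFst a m n)).add
    ((((SumsTo.X z).pow (2 * m + 1)).mul (h2.mul h2)).C_mul (dihedralSnd a m n))
  rw [dihedral_formal] at h
  rw [(dihedralSum_sumsTo a m n z).unique h, show (1 / 2 - m : ℂ) = -m + 1 / 2 by ring,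
    show (m + 3 / 2 : ℂ) = (m + 1 : ℕ) + 1 / 2 by push_cast; ring]
  ring

end TerminatingEvaluation

/-! ### Assembly of the identities. -/

theorem theorem2 :
    -- generalization of Chaundy's identity
    (∀ a b c : ℂ, (∀ k : ℕ, c ≠ -(k : ℂ)) → (∀ k : ℕ, 2 - c ≠ -(k : ℂ)) →
      ∀ᶠ z : ℂ in 𝓝 0,
        Summable (doubleTerm
          (coeff122 (1 / 2) (a - b + 1 / 2) (a + b - c + 1 / 2)
            (b - a + 1 / 2) (c - a - b + 1 / 2) c (2 - c)) z (z / (z - 1))) ∧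
        ordinaryHypergeometric a b c z *
            ordinaryHypergeometric (1 + a - c) (1 + b - c) (2 - c) z =
          (1 - z) ^ (c - a - b - 1 / 2) *
            doubleSeries
              (coeff122 (1 / 2) (a - b + 1 / 2) (a + b - c + 1 / 2)
                (b - a + 1 / 2) (c - a - b + 1 / 2) c (2 - c)) z (z / (z - 1))) ∧
    -- generalization of Clausen's identity, `a + b + n` not a non-positive integer
    (∀ (a b : ℂ) (n : ℕ), (∀ k : ℕ, a + b + 1 / 2 ≠ -(k : ℂ)) →
      (∀ k : ℕ, a + b + n ≠ -(k : ℂ)) →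
      ∀ᶠ z : ℂ in 𝓝 0,
        Summable (doubleTerm (terminateSnd n (clausenCoeff a b n)) z (1 - z)) ∧
        poch (a + 1 / 2) n * poch (b + 1 / 2) n *
            ordinaryHypergeometric a b (a + b + n + 1 / 2) z ^ 2 =
          poch (1 / 2) n * poch (a + b + 1 / 2) n *
            doubleSeries (terminateSnd n (clausenCoeff a b n)) z (1 - z) ∧
        (poch (a + 1 / 2) n ≠ 0 → poch (b + 1 / 2) n ≠ 0 →
          ordinaryHypergeometric a b (a + b + n + 1 / 2) z ^ 2 =
            (poch (1 / 2) n * poch (a + b + 1 / 2) n) /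
                (poch (a + 1 / 2) n * poch (b + 1 / 2) n) *
              doubleSeries (terminateSnd n (clausenCoeff a b n)) z (1 - z))) ∧
    -- the same for `a + b + n = -m`, with the term-wise limit in the second parameter
    (∀ (a b : ℂ) (n m : ℕ), a + b + n = -(m : ℂ) →
      ∃ t : ℕ → ℕ → ℂ,
        (∀ i j : ℕ, j ≤ n →
          Tendsto (fun b' : ℂ => clausenCoeff a b' n i j) (𝓝[≠] b) (𝓝 (t i j))) ∧
        ∀ᶠ z : ℂ in 𝓝 0,
          Summable (doubleTerm (terminateSnd n t) z (1 - z)) ∧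
          poch (a + 1 / 2) n * poch (b + 1 / 2) n *
              ordinaryHypergeometric a b (a + b + n + 1 / 2) z ^ 2 =
            poch (1 / 2) n * poch (a + b + 1 / 2) n *
              doubleSeries (terminateSnd n t) z (1 - z) ∧
          (poch (a + 1 / 2) n ≠ 0 → poch (b + 1 / 2) n ≠ 0 →
            ordinaryHypergeometric a b (a + b + n + 1 / 2) z ^ 2 =
              (poch (1 / 2) n * poch (a + b + 1 / 2) n) /
                  (poch (a + 1 / 2) n * poch (b + 1 / 2) n) *
                doubleSeries (terminateSnd n t) z (1 - z))) ∧
    -- the dihedral case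
    (∀ (a : ℂ) (m n : ℕ),
      ∀ᶠ z : ℂ in 𝓝 0,
        (poch (a + 1 / 2) n * poch (a + m + 1 / 2) n) /
              (poch (1 / 2) n * poch (m + 1 / 2) n) *
            ordinaryHypergeometric a (-a - m - n) (1 / 2 - m) z ^ 2 +
          (poch (a + 1 / 2) m * poch (a + n + 1 / 2) m * poch a (m + n + 1) ^ 2) /
                (poch (1 / 2) m * poch (1 / 2) (m + 1) ^ 2 * poch (1 / 2) n *
                  poch (1 / 2) (m + n)) *
              z ^ (2 * m + 1) *
            ordinaryHypergeometric (a + m + 1 / 2) (1 / 2 - a - n) (m + 3 / 2) z ^ 2 =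
        rectSum m n
          (coeff211 (2 * a) (-(2 * a) - 2 * m - 2 * n) (-m) (-n)
            (1 / 2 - m - n) (-(2 * m)) (-(2 * n))) z (1 - z)) := by
  refine ⟨fun a b c hc hc' => chaundy_eventually hc hc', fun a b n hc hp => ?_,
    fun a b n m h => ?_, fun a m n => ?_⟩
  · have hc := add_ne_zero_of_ne_neg hc
    have hp := add_ne_zero_of_ne_neg hp
    have hw (k : ℕ) : a + b + n + 1 / 2 + k ≠ 0 := by
      have := hc (n + k)
      push_cast at this
      rwa [show a + b + n + 1 / 2 + k = a + b + 1 / 2 + (n + k) by ring]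
    have e : terminateSnd n (clausenCoeff a b n) = clausenArray a b n := by
      rw [← terminateSnd_clausenArray]
      funext i j
      rw [terminateSnd, terminateSnd]
      split_ifs with hj
      · exact clausenCoeff_eq hw (poch_two_mul_ne_zero hc hp i) hj
      · rfl
    rw [e]
    exact clausen_eventually hc
  -- Here a+b is an integer, so a+b+1/2 is a half-integer and the lower parameter is automatically
  -- admissible.
  · have hc (k : ℕ) : a + b + 1 / 2 + k ≠ 0 := fun hk => by
      have : ((2 * k + 1 : ℕ) : ℂ) = (2 * (m + n) : ℕ) := by
        push_cast
        linear_combination 2 * hk - 2 * h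
      have : 2 * k + 1 = 2 * (m + n) := by exact_mod_cast this
      omega
    refine ⟨clausenArray a b n, fun i j hj => tendsto_clausenCoeff h hc i hj, ?_⟩
    rw [terminateSnd_clausenArray]
    exact clausen_eventually hc
  · filter_upwards [dihedral_eventually a m n] with z hz
    rw [rectSum_eq (fun i hi j hj => dihedralArray_eq a hi hj)]
    exact hz
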